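/- Let $V$ be a vector space of finite dimension $N>1$ over a field $\mathbb{F}$, and let $n,d_0,d$ be non-negative integers with $n>1$ and $2n+d_0+d=N$. Let $\eta$ be a (possibly degenerate) Hermitian, alternating or quadratic form on $V$. Here a Hermitian form is a $\sigma$-sesquilinear form $h$ with $h(y,x)=h(x,y)^\sigma$ for a non-trivial automorphism $\sigma$ of $\mathbb{F}$ with $\sigma^2=1$. The radical $\mathrm{Rad}(\eta)$ consists of the vectors orthogonal to all of $V$ and, if $\eta=q$ is quadratic, it consists of the vectors $x$ with $q(x)=0$ that are orthogonal to all of $V$ with respect to the bilinearization $f_q(x,y)=q(x+y)-q(x)-q(y)$. A subspace is totally singular if $\eta$ vanishes identically on it. Assume that $\dim\mathrm{Rad}(\eta)=d$, that $\eta$ has reduced Witt index $n$ (that is, $n$ is the largest dimension of a subspace of $V/\mathrm{Rad}(\eta)$ that is totally singular for the non-degenerate form induced by $\eta$), and that $\eta$ has anisotropic defect $d_0=N-2n-d$. For $1\le k\le n$ let $\mathcal{P}_k$ be the polar $k$-Grassmannian of $\eta$, whose points are the $k$-dimensional totally singular subspaces of $V$, and let $\varepsilon_k:\mathcal{P}_k\to\mathrm{PG}(\bigwedge^kV)$,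 $\langle v_1,\dots,v_k\rangle\mapsto\langle v_1\wedge\dots\wedge v_k\rangle$, be its Grassmann (Plücker) embedding. Let $\langle\varepsilon_k(\mathcal{P}_k)\rangle$ be the subspace spanned by its image and $\dim(\varepsilon_k)$ the vector space dimension of this span. With the convention $\binom{N}{-1}=0$, the following hold. 1. If $\eta$ is Hermitian, then $\dim(\varepsilon_k)=\binom{N}{k}$, that is, $\varepsilon_k(\mathcal{P}_k)$ spans $\mathrm{PG}(\bigwedge^kV)$. 2. If $\eta$ is alternating, then $\dim(\varepsilon_k)=\binom{N}{k}-\binom{N}{k-2}$. 3. If $\eta=q$ is quadratic, then $\dim(\varepsilon_k)=\binom{N}{k}$ when $\mathrm{char}(\mathbb{F})\neq2$, and $\dim(\varepsilon_k)=\binom{N}{k}-\binom{N}{k-2}$ when $\mathrm{char}(\mathbb{F})=2$. If $\mathrm{char}(\mathbb{F})\ne2$ or $k=1$, then $\varepsilon_k(\mathcal{P}_k)$ spans $\mathrm{PG}(\bigwedge^kV)$. If $\mathrm{char}(\mathbb{F})=2$, then $\langle\varepsilon_k(\mathcal{P}_k)\rangle$ coincides with the span of the image of the Grassmann embedding of the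 symplectic $k$-Grassmannian associated with the alternating form $f_q$, whose points are the $k$-dimensional totally singular subspaces for $f_q$. -/

import Mathlib

open Module
open scoped LinearAlgebra.Projectivization

universe u v

/-- The binomial coefficient `C(m, j)` with the convention `C(m, j) = 0` for `j < 0`. -/
def binomial (m : ℕ) (j : ℤ) : ℤ :=
  if 0 ≤ j then (m.choose j.toNat : ℤ) else 0

/-- A point-line geometry; each line is given by its set of points. -/
structure PointLineGeometry where
  /-- the points -/
  Point : Type v
  /-- the lines -/
  lines : Set (Set Point)

section Grassmannian

variable (F : Type u) [Field F] (V : Type v) [AddCommGroup V] [Module F V]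

/-- The points of the `k`-Grassmannian of `V`: the `k`-dimensional subspaces. -/
abbrev GrassmannPoint (k : ℕ) : Type v := {X : Submodule F V // finrank F X = k}

variable {F V}

/-- The set `ℓ_{X,Y}` of the `k`-dimensional subspaces strictly between `X` and `Y`. -/
def grassmannLine (k : ℕ) (X Y : Submodule F V) : Set (GrassmannPoint F V k) :=
  {Z | X < Z.1 ∧ Z.1 < Y}

variable [FiniteDimensional F V]

/-- The image of `⋀^k X` in `⋀^k V` is one-dimensional when `dim X = k`. -/
theorem finrank_range_exteriorPower_map {k : ℕ} (X : GrassmannPoint F V k) :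
    finrank F (LinearMap.range (exteriorPower.map k X.1.subtype)) = 1 := by
  rw [LinearMap.finrank_range_of_inj
    (exteriorPower.map_injective_field X.1.injective_subtype), exteriorPower.finrank_eq, X.2,
    Nat.choose_self]

/-- The Plücker embedding `e_k` of the `k`-Grassmannian of `V` in `PG(⋀^k V)`. A `k`-dimensional
subspace `X` goes to the line `⋀^k X` of `⋀^k V`, which is `⟨v₁ ∧ ⋯ ∧ v_k⟩` for every basis
`v₁, …, v_k` of `X` (see `pluckerMap_eq_mk`). -/
noncomputable def pluckerMap (k : ℕ) (X : GrassmannPoint F V k) : ℙ F (⋀[F]^k V) :=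
  Projectivization.mk'' (LinearMap.range (exteriorPower.map k X.1.subtype))
    (finrank_range_exteriorPower_map X)

/-- The Plücker embedding maps `⟨v₁, …, v_k⟩` to `⟨v₁ ∧ ⋯ ∧ v_k⟩`. -/
theorem pluckerMap_eq_mk {k : ℕ} (X : GrassmannPoint F V k) (b : Basis (Fin k) F X.1) :
    ∃ h : exteriorPower.ιMulti F k (fun i => (b i : V)) ≠ 0,
      pluckerMap k X = Projectivization.mk F _ h := by
  have hli : LinearIndependent F (fun i => (b i : V)) :=
    b.linearIndependent.map' X.1.subtype X.1.ker_subtype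
  have h : exteriorPower.ιMulti F k (fun i => (b i : V)) ≠ 0 := by
    simpa [exteriorPower.ιMulti_family, Function.comp_def] using
      (exteriorPower.ιMulti_family_linearIndependent_field (n := k) hli).ne_zero
        (Set.powersetCard.ofFinEmbEquiv (RelEmbedding.refl (· ≤ ·)))
  refine ⟨h, ?_⟩
  apply Projectivization.submodule_injective
  rw [pluckerMap, Projectivization.submodule_mk'', Projectivization.submodule_mk]
  symm
  apply Submodule.eq_of_le_of_finrank_eq
  · rw [Submodule.span_singleton_le_iff_mem]
    exact ⟨exteriorPower.ιMulti F k b, by rw [exteriorPower.map_apply_ιMulti]; rfl⟩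
  · rw [finrank_range_exteriorPower_map, finrank_span_singleton h]

end Grassmannian

/-- A (possibly degenerate) Hermitian, alternating or quadratic form on `V`. A Hermitian form is
a `σ`-sesquilinear form `h` (semilinear in the first variable, linear in the second one) with
`h y x = σ (h x y)`, where `σ` is an involutory, non-trivial automorphism of the field. -/
inductive PolarForm (F : Type u) [Field F] (V : Type v) [AddCommGroup V] [Module F V] :
    Type (max u v)
  | hermitian (σ : F →+* F) (hσ : Function.Involutive σ) (hσ' : σ ≠ RingHom.id F)
      (h : V →ₛₗ[σ] V →ₗ[F] F) (hh : h.IsSymm)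
  | alternating (s : LinearMap.BilinForm F V) (hs : s.IsAlt)
  | quadratic (q : QuadraticForm F V)

namespace PolarForm

variable {F : Type u} [Field F] {V : Type v} [AddCommGroup V] [Module F V]

/-- The form is Hermitian. -/
def IsHermitian : PolarForm F V → Prop
  | hermitian _ _ _ _ _ => True
  | _ => False

/-- The form is alternating. -/
def IsAlternating : PolarForm F V → Prop
  | alternating _ _ => True
  | _ => False

/-- The radical: the vectors orthogonal to all vectors and, for a quadratic form, also singular
(orthogonality then refers to the bilinearization). -/
def radical : PolarForm F V → Submodule F V
  | hermitian _ _ _ h _ => LinearMap.ker h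
  | alternating s _ => LinearMap.ker s
  | quadratic q => q.radical

/-- A subspace is totally singular if the form vanishes on it identically. -/
def TotallySingular : PolarForm F V → Submodule F V → Prop
  | hermitian _ _ _ h _, X => ∀ x ∈ X, ∀ y ∈ X, h x y = 0
  | alternating s _, X => ∀ x ∈ X, ∀ y ∈ X, s x y = 0
  | quadratic q, X => ∀ x ∈ X, q x = 0

/-- Two vectors are orthogonal; for a quadratic form with respect to its bilinearization. -/
def Orthogonal : PolarForm F V → V → V → Prop
  | hermitian _ _ _ h _, x, y => h x y = 0
  | alternating s _, x, y => s x y = 0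
  | quadratic q, x, y => q.polarBilin x y = 0

/-- The non-degenerate form induced on the quotient of `V` by the radical. -/
def reduction : (η : PolarForm F V) → PolarForm F (V ⧸ η.radical)
  | hermitian σ hσ hσ' h hh =>
      hermitian σ hσ hσ' (hh.isRefl.liftQ₂ h (LinearMap.ker h) le_rfl) ⟨by
        intro x y
        induction x using Submodule.Quotient.induction_on with | _ x
        induction y using Submodule.Quotient.induction_on with | _ y
        exact hh.eq x y⟩
  | alternating s hs =>
      alternating (hs.isRefl.liftQ₂ s (LinearMap.ker s) le_rfl) (by
        intro x
        induction x using Submodule.Quotient.induction_on with | _ x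
        exact hs x)
  | quadratic q => quadratic (q.lift q.radical le_rfl)

/-- The Witt index: the largest dimension of a totally singular subspace. -/
noncomputable def wittIndex (η : PolarForm F V) : ℕ :=
  sSup {m | ∃ X : Submodule F V, η.TotallySingular X ∧ finrank F X = m}

/-- The reduced Witt index: the Witt index of the form induced on `V / Rad`. -/
noncomputable def reducedWittIndex (η : PolarForm F V) : ℕ := η.reduction.wittIndex

/-- The (singular) defect: the dimension of the radical. -/
noncomputable def defect (η : PolarForm F V) : ℕ := finrank F η.radical

/-- The anisotropic defect `N - 2 n - d`, where `N = dim V`, `n` is the reduced Witt index and `d`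
is the defect; it is the dimension of `V₀` in any decomposition
`V = (V₁ ⊕ ⋯ ⊕ V_n) ⊕ V₀ ⊕ Rad` with `V₁, …, V_n` mutually orthogonal hyperbolic planes and `V₀`
totally anisotropic and orthogonal to each of them. -/
noncomputable def anisotropicDefect (η : PolarForm F V) : ℕ :=
  finrank F V - 2 * η.reducedWittIndex - η.defect

/-- The points of the polar `k`-Grassmannian: the `k`-dimensional totally singular subspaces. -/
abbrev PolarPoint (η : PolarForm F V) (k : ℕ) : Type v :=
  {X : GrassmannPoint F V k // η.TotallySingular X.1}

/-- The polar `k`-Grassmannian. If `k` is smaller than the Witt index, the lines are the lines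
`ℓ_{X,Y}` of the `k`-Grassmannian of `V` with `Y` totally singular. If `k` is equal to the Witt
index, they are the sets of all points `Y` containing a given totally singular `X` with
`dim X = k - 1` (and contained in `X^⊥`, which holds for all such `Y`). There are no points when
`k` exceeds the Witt index. -/
def polarGrassmannian (η : PolarForm F V) (k : ℕ) : PointLineGeometry.{v} where
  Point := η.PolarPoint k
  lines := {l |
    (k < η.wittIndex ∧ ∃ X Y : Submodule F V, finrank F X + 1 = k ∧ finrank F Y = k + 1 ∧
      X < Y ∧ η.TotallySingular Y ∧ l = {Z | Z.1 ∈ grassmannLine k X Y}) ∨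
    (k = η.wittIndex ∧ ∃ X : Submodule F V, finrank F X + 1 = k ∧ η.TotallySingular X ∧
      l = {Y | X ≤ Y.1.1 ∧ ∀ x ∈ X, ∀ y ∈ Y.1.1, η.Orthogonal x y})}

section Embedding

variable [FiniteDimensional F V]

/-- The Grassmann embedding `ε_k` of the polar `k`-Grassmannian: the restriction to its points of
the Plücker embedding of the `k`-Grassmannian of `V`. -/
noncomputable def grassmannEmbedding (η : PolarForm F V) (k : ℕ) :
    (η.polarGrassmannian k).Point → ℙ F (⋀[F]^k V) :=
  fun X : η.PolarPoint k => pluckerMap k X.1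

/-- The projective subspace of `PG(⋀^k V)` spanned by the image of `ε_k`. -/
noncomputable def embeddingSpan (η : PolarForm F V) (k : ℕ) :
    Projectivization.Subspace F (⋀[F]^k V) :=
  Projectivization.Subspace.span (Set.range (η.grassmannEmbedding k))

/-- The dimension of `ε_k`: the vector space dimension of the span of its image. -/
noncomputable def embeddingDim (η : PolarForm F V) (k : ℕ) : ℕ :=
  finrank F (Projectivization.Subspace.submodule (η.embeddingSpan k))

end Embedding

/-- The bilinearization `f_q(x, y) = q(x + y) - q(x) - q(y)` of a quadratic form in
characteristic `2`, as an alternating form. -/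
def bilinearization [CharP F 2] (q : QuadraticForm F V) : PolarForm F V :=
  alternating q.polarBilin (by
    intro x
    have h2 : (2 : F) = 0 := CharTwo.two_eq_zero
    simp [QuadraticMap.polar_self, ← Nat.cast_smul_eq_nsmul F, h2])

end PolarForm

/-! Seen in the exterior algebra, the span of the image of `ε_k` is `singularSpan`, the span of the
products of `k` mutually orthogonal singular vectors (`map_submodule_embeddingSpan`). Everything is
then a statement about such products.

Hermitian forms, and quadratic forms in characteristic not 2: all of `⋀^k V` is reached, by
induction on `k`. Take a product of fewer than `n` mutually orthogonal singular vectors and multiply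
it by any `x`. If `x` is orthogonal to all factors, it is a sum of singular vectors that are too
(`mem_span_singular`). If a factor `p` is not orthogonal to `x`, subtracting multiples of `p` makes
the other factors orthogonal to `x`, and there is still room for a hyperbolic pair `a, b` orthogonal
to all of these vectors. Modulo products of orthogonal singular vectors of `⟨p, x, a, b⟩`, one has
`p ∧ x ≡ (c / σ c) a ∧ b` for every `c ≠ 0` in the Hermitian case, and two values of `c / σ c` force
both sides to vanish. In the quadratic case `p ∧ x ≡ a ∧ b ≡ b ∧ a`, so `2 p ∧ x ≡ 0`. This is
`HyperbolicExchange`.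

Alternating forms: the span is squeezed between two spaces of the same dimension. It lies in the
common kernel of all divided powers, of order at least 1, of the contraction with the form; divided
powers make this work in every characteristic. To allow induction on the number of hyperbolic pairs,
both spaces get a parameter `j`: `contractionKernel` (killed in orders at least `j`) and `pairSpan`
(fewer than `j` non-orthogonal pairs allowed). Splitting off one hyperbolic plane bounds both by the
recursion that `binomial m k - binomial m (k - 2 * j)` satisfies when `m` grows by 2
(`finrank_contractionKernel_le`, `le_finrank_pairSpan`); `j = 1` is the case needed.

Quadratic forms in characteristic 2: the factors of a product isotropic for `f_q` can be replaced
one by one by singular vectors (`singularSpan_eq_of_isotropic`), so the span is the symplectic one.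
-/

namespace ExteriorAlgebra

/-! ### Products of vectors, contractions and graded pieces in the exterior algebra -/

section Wedge

variable {F : Type u} [Field F] {V : Type v} [AddCommGroup V] [Module F V]

instance finite_of_finiteDimensional [FiniteDimensional F V] :
    Module.Finite F (ExteriorAlgebra F V) := by
  let b := Module.finBasis F V
  exact Module.Finite.of_basis b.ExteriorAlgebra

/-- The product `v₁ ∧ ⋯ ∧ v_k` of a list of vectors. -/
def wedge (F : Type u) [Field F] {V : Type v} [AddCommGroup V] [Module F V] (l : List V) :
    ExteriorAlgebra F V :=
  (l.map (ι F)).prod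

@[simp] lemma wedge_nil : wedge F ([] : List V) = 1 := rfl

@[simp] lemma wedge_cons (x : V) (l : List V) : wedge F (x :: l) = ι F x * wedge F l := by
  simp [wedge]

@[simp] lemma wedge_append (l l' : List V) : wedge F (l ++ l') = wedge F l * wedge F l' := by
  simp [wedge]

lemma ι_mul_ι_swap (x y : V) : ι F x * ι F y = -(ι F y * ι F x) :=
  eq_neg_of_add_eq_zero_left (ι_add_mul_swap x y)

lemma ι_mul_ι_mul_self (x : V) (z : ExteriorAlgebra F V) : ι F x * (ι F x * z) = 0 := by
  rw [← mul_assoc, ι_sq_zero, zero_mul]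

lemma ι_mul_ι_mul_swap (x y : V) (z : ExteriorAlgebra F V) :
    ι F x * (ι F y * z) = -(ι F y * (ι F x * z)) := by
  rw [← mul_assoc, ι_mul_ι_swap, neg_mul, mul_assoc]

lemma wedge_middle (l l' : List V) (x : V) :
    wedge F (l ++ x :: l') = (-1 : F) ^ l.length • wedge F (x :: (l ++ l')) := by
  induction l with
  | nil => simp
  | cons y l ih =>
    rw [List.cons_append, wedge_cons, ih, mul_smul_comm, wedge_cons, ι_mul_ι_mul_swap y x]
    simp [pow_succ]

/-- A product of two vectors is central. -/
lemma commute_ι_mul_ι (x y : V) (z : ExteriorAlgebra F V) : Commute (ι F x * ι F y) z := by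
  induction z using ExteriorAlgebra.induction with
  | algebraMap r => exact (Algebra.commutes r _).symm
  | ι w =>
    rw [Commute, SemiconjBy, mul_assoc, ι_mul_ι_swap y w, mul_neg, ← mul_assoc, ι_mul_ι_swap x w,
      neg_mul, neg_neg, mul_assoc]
  | mul a b ha hb => exact ha.mul_right hb
  | add a b ha hb => exact ha.add_right hb

/-- Contraction by a linear functional. -/
noncomputable def contract (d : Dual F V) : ExteriorAlgebra F V →ₗ[F] ExteriorAlgebra F V :=
  CliffordAlgebra.contractLeft d

lemma contract_ι_mul (d : Dual F V) (x : V) (z : ExteriorAlgebra F V) :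
    contract d (ι F x * z) = d x • z - ι F x * contract d z :=
  CliffordAlgebra.contractLeft_ι_mul d x z

lemma contract_one (d : Dual F V) : contract d (1 : ExteriorAlgebra F V) = 0 :=
  CliffordAlgebra.contractLeft_one _ d

lemma contract_contract (d : Dual F V) (z : ExteriorAlgebra F V) :
    contract d (contract d z) = 0 :=
  CliffordAlgebra.contractLeft_contractLeft d z

lemma contract_comm (d d' : Dual F V) (z : ExteriorAlgebra F V) :
    contract d (contract d' z) = -contract d' (contract d z) :=
  CliffordAlgebra.contractLeft_comm d d' z

lemma contract_add (d d' : Dual F V) : contract (d + d') = contract d + contract d' :=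
  map_add CliffordAlgebra.contractLeft d d'

lemma contract_sub (d d' : Dual F V) : contract (d - d') = contract d - contract d' :=
  map_sub CliffordAlgebra.contractLeft d d'

lemma contract_smul (c : F) (d : Dual F V) : contract (c • d) = c • contract d :=
  map_smul CliffordAlgebra.contractLeft c d

lemma contract_zero : contract (0 : Dual F V) = 0 :=
  map_zero CliffordAlgebra.contractLeft

lemma contract_wedge_eq_zero {d : Dual F V} {l : List V} (h : ∀ x ∈ l, d x = 0) :
    contract d (wedge F l) = 0 := by
  induction l with
  | nil => exact contract_one d
  | cons x l ih =>
    simp only [List.forall_mem_cons] at h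
    rw [wedge_cons, contract_ι_mul, h.1, ih h.2]
    simp

/-- The image of `⋀^k W` in the exterior algebra of `V`; zero if `k` is negative. -/
noncomputable def gradePiece (W : Submodule F V) (k : ℤ) : Submodule F (ExteriorAlgebra F V) :=
  if 0 ≤ k then (W.map (ι F)) ^ k.toNat else ⊥

lemma gradePiece_natCast (W : Submodule F V) (k : ℕ) :
    gradePiece W (k : ℤ) = (W.map (ι F)) ^ k := by
  simp [gradePiece]

lemma gradePiece_of_neg (W : Submodule F V) {k : ℤ} (hk : k < 0) : gradePiece W k = ⊥ := by
  simp [gradePiece, hk]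

lemma gradePiece_eq_span (W : Submodule F V) (k : ℤ) :
    gradePiece W k =
      Submodule.span F {w | ∃ l : List V, (∀ x ∈ l, x ∈ W) ∧ (l.length : ℤ) = k ∧ w = wedge F l} := by
  rcases lt_or_ge k 0 with hk | hk
  · rw [gradePiece_of_neg W hk, eq_comm, Submodule.span_eq_bot]
    rintro w ⟨l, -, h, -⟩
    omega
  lift k to ℕ using hk
  rw [gradePiece_natCast]
  induction k with
  | zero =>
    rw [pow_zero, Submodule.one_eq_span]
    congr 1
    ext w
    simp only [Set.mem_singleton_iff, Set.mem_ofPred_eq, Nat.cast_zero, Nat.cast_eq_zero,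
      List.length_eq_zero_iff]
    constructor
    · rintro rfl
      exact ⟨[], by simp⟩
    · rintro ⟨l, -, rfl, rfl⟩
      simp
  | succ k ih =>
    rw [pow_succ', ih]
    apply le_antisymm
    · rw [Submodule.mul_le]
      rintro _ ⟨x, hx, rfl⟩ n hn
      induction hn using Submodule.span_induction with
      | mem w hw =>
        obtain ⟨l, hl, hk, rfl⟩ := hw
        refine Submodule.subset_span ⟨x :: l, ?_, ?_, by simp⟩
        · simpa using ⟨hx, hl⟩
        · simp_all
      | zero => simp
      | add a b _ _ ha hb => rw [mul_add]; exact add_mem ha hb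
      | smul c a _ ha => rw [mul_smul_comm]; exact Submodule.smul_mem _ c ha
    · rw [Submodule.span_le]
      rintro w ⟨l, hl, hk, rfl⟩
      cases l with
      | nil => simp at hk; omega
      | cons x l =>
        simp only [List.forall_mem_cons] at hl
        rw [wedge_cons]
        refine Submodule.mul_mem_mul ⟨x, hl.1, rfl⟩ (Submodule.subset_span ⟨l, hl.2, ?_, rfl⟩)
        simp at hk
        omega

lemma wedge_mem_gradePiece {W : Submodule F V} {l : List V} (h : ∀ x ∈ l, x ∈ W) :
    wedge F l ∈ gradePiece W l.length := by
  rw [gradePiece_eq_span]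
  exact Submodule.subset_span ⟨l, h, rfl, rfl⟩

lemma ι_mul_mem_gradePiece {W : Submodule F V} {x : V} (hx : x ∈ W) {k : ℤ}
    {z : ExteriorAlgebra F V} (hz : z ∈ gradePiece W (k - 1)) : ι F x * z ∈ gradePiece W k := by
  rw [gradePiece_eq_span] at hz ⊢
  induction hz using Submodule.span_induction with
  | mem w hw =>
    obtain ⟨l, hl, hk, rfl⟩ := hw
    refine Submodule.subset_span ⟨x :: l, ?_, ?_, by simp⟩
    · simpa using ⟨hx, hl⟩
    · simp [hk]
  | zero => simp
  | add a b _ _ ha hb => rw [mul_add]; exact add_mem ha hb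
  | smul c a _ ha => rw [mul_smul_comm]; exact Submodule.smul_mem _ c ha

lemma contract_eq_zero_of_mem_gradePiece {W : Submodule F V} {d : Dual F V}
    (h : ∀ x ∈ W, d x = 0) {k : ℤ} {z : ExteriorAlgebra F V} (hz : z ∈ gradePiece W k) :
    contract d z = 0 := by
  rw [gradePiece_eq_span] at hz
  induction hz using Submodule.span_induction with
  | mem w hw =>
    obtain ⟨l, hl, -, rfl⟩ := hw
    exact contract_wedge_eq_zero fun x hx => h x (hl x hx)
  | zero => simp
  | add a b _ _ ha hb => rw [map_add, ha, hb, add_zero]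
  | smul c a _ ha => rw [map_smul, ha, smul_zero]

lemma finrank_gradePiece [FiniteDimensional F V] (W : Submodule F V) (k : ℤ) :
    (finrank F (gradePiece W k) : ℤ) = binomial (finrank F W) k := by
  rcases lt_or_ge k 0 with hk | hk
  · rw [gradePiece_of_neg W hk, finrank_bot, binomial, if_neg (not_le.mpr hk), Nat.cast_zero]
  lift k to ℕ using hk
  have h : gradePiece W k = (⋀[F]^k W).map (map W.subtype).toLinearMap := by
    rw [gradePiece_natCast, exteriorPower, Submodule.map_pow, ι_range_map_map,
      Submodule.range_subtype]
  have hinj : Function.Injective (map W.subtype) :=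
    map_injective_field W.ker_subtype
  rw [h, ← (Submodule.equivMapOfInjective _ hinj _).finrank_eq, exteriorPower.finrank_eq]
  simp [binomial]

end Wedge

end ExteriorAlgebra

/-! ### Rank bounds from a linear map restricted to a subspace -/

section Rank

variable {F : Type u} [Field F] {A : Type v} [AddCommGroup A] [Module F A] [FiniteDimensional F A]

lemma Submodule.finrank_map_add_finrank_inf_ker (φ : A →ₗ[F] A) (M : Submodule F A) :
    finrank F (M.map φ) + finrank F ↥(M ⊓ LinearMap.ker φ) = finrank F M := by
  have h := LinearMap.finrank_range_add_finrank_ker (φ.domRestrict M)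
  have h1 : LinearMap.range (φ.domRestrict M) = M.map φ := by
    rw [LinearMap.domRestrict, LinearMap.range_comp, Submodule.range_subtype]
  have h2 : (LinearMap.ker (φ.domRestrict M)).map M.subtype = M ⊓ LinearMap.ker φ := by
    rw [LinearMap.domRestrict, LinearMap.ker_comp, Submodule.map_comap_subtype]
  rw [h1] at h
  rw [← h2, Submodule.finrank_map_subtype_eq]
  exact h

/-- This bound and the next one are applied along successive kernels, so that the components of an
element are counted one at a time. -/
lemma Submodule.finrank_le_of_map_le (φ : A →ₗ[F] A) {M N : Submodule F A} (h : M.map φ ≤ N) :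
    finrank F M ≤ finrank F N + finrank F ↥(M ⊓ LinearMap.ker φ) := by
  have := Submodule.finrank_mono h
  have := Submodule.finrank_map_add_finrank_inf_ker φ M
  omega

lemma Submodule.le_finrank_of_le_map (φ : A →ₗ[F] A) {M N : Submodule F A} (h : N ≤ M.map φ) :
    finrank F N + finrank F ↥(M ⊓ LinearMap.ker φ) ≤ finrank F M := by
  have := Submodule.finrank_mono h
  have := Submodule.finrank_map_add_finrank_inf_ker φ M
  omega

end Rank

namespace ExteriorAlgebra

variable {F : Type u} [Field F] {V : Type v} [AddCommGroup V] [Module F V]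

/-! ### Splitting off a plane `⟨e, f⟩` from the exterior algebra -/

section DualPair

/-- The functionals `d₁, d₂` restrict to the basis dual to `e, f` on the span of `e, f`. -/
structure DualPair (e f : V) (d₁ d₂ : Dual F V) : Prop where
  d₁e : d₁ e = 1
  d₁f : d₁ f = 0
  d₂e : d₂ e = 0
  d₂f : d₂ f = 1

/-- Both contractions vanish on `z`: it does not involve `e, f`. -/
def Free (d₁ d₂ : Dual F V) (z : ExteriorAlgebra F V) : Prop :=
  contract d₁ z = 0 ∧ contract d₂ z = 0

/-- The projection that kills all multiples of `e` and `f`. -/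
noncomputable def killPair (e f : V) (d₁ d₂ : Dual F V) :
    ExteriorAlgebra F V →ₗ[F] ExteriorAlgebra F V :=
  (LinearMap.id - LinearMap.mulLeft F (ι F f) ∘ₗ contract d₂) ∘ₗ
    (LinearMap.id - LinearMap.mulLeft F (ι F e) ∘ₗ contract d₁)

variable {e f : V} {d₁ d₂ : Dual F V} {a b c t : ExteriorAlgebra F V}

lemma DualPair.contract₁ (h : DualPair e f d₁ d₂) (ha : Free d₁ d₂ a) (hb : Free d₁ d₂ b)
    (hc : Free d₁ d₂ c) (ht : Free d₁ d₂ t) :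
    contract d₁ (a + ι F e * b + ι F f * c + ι F e * (ι F f * t)) = b + ι F f * t := by
  simp only [map_add, contract_ι_mul, h.d₁e, h.d₁f, ha.1, hb.1, hc.1, ht.1]
  simp

lemma DualPair.contract₂ (h : DualPair e f d₁ d₂) (ha : Free d₁ d₂ a) (hb : Free d₁ d₂ b)
    (hc : Free d₁ d₂ c) (ht : Free d₁ d₂ t) :
    contract d₂ (a + ι F e * b + ι F f * c + ι F e * (ι F f * t)) = c - ι F e * t := by
  simp only [map_add, contract_ι_mul, h.d₂e, h.d₂f, ha.2, hb.2, hc.2, ht.2]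
  simp [sub_eq_add_neg]

lemma DualPair.contract₂₁ (h : DualPair e f d₁ d₂) (ha : Free d₁ d₂ a) (hb : Free d₁ d₂ b)
    (hc : Free d₁ d₂ c) (ht : Free d₁ d₂ t) :
    contract d₂ (contract d₁ (a + ι F e * b + ι F f * c + ι F e * (ι F f * t))) = t := by
  rw [h.contract₁ ha hb hc ht]
  simp only [map_add, contract_ι_mul, h.d₂f, hb.2, ht.2]
  simp

lemma DualPair.killPair_apply (h : DualPair e f d₁ d₂) (ha : Free d₁ d₂ a) (hb : Free d₁ d₂ b)
    (hc : Free d₁ d₂ c) (ht : Free d₁ d₂ t) :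
    killPair e f d₁ d₂ (a + ι F e * b + ι F f * c + ι F e * (ι F f * t)) = a := by
  simp only [killPair, LinearMap.comp_apply, LinearMap.sub_apply, LinearMap.id_apply,
    LinearMap.mulLeft_apply, h.contract₁ ha hb hc ht]
  have : a + ι F e * b + ι F f * c + ι F e * (ι F f * t) - ι F e * (b + ι F f * t) =
      a + ι F f * c := by noncomm_ring
  rw [this]
  simp only [map_add, contract_ι_mul, h.d₂f, ha.2, hc.2]
  simp

lemma free_of_mem_gradePiece {U : Submodule F V} (hU : ∀ u ∈ U, d₁ u = 0 ∧ d₂ u = 0) {k : ℤ}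
    (ha : a ∈ gradePiece U k) : Free d₁ d₂ a :=
  ⟨contract_eq_zero_of_mem_gradePiece (fun u hu => (hU u hu).1) ha,
    contract_eq_zero_of_mem_gradePiece (fun u hu => (hU u hu).2) ha⟩

lemma free_zero : Free d₁ d₂ (0 : ExteriorAlgebra F V) := by simp [Free]

/-- `⋀^k (⟨e, f⟩ + U) = ⋀^k U + e ∧ ⋀^(k-1) U + f ∧ ⋀^(k-1) U + e ∧ f ∧ ⋀^(k-2) U`. -/
lemma exists_of_mem_gradePiece_sup (e f : V) (U : Submodule F V) {k : ℤ}
    {z : ExteriorAlgebra F V} (hz : z ∈ gradePiece (Submodule.span F {e, f} ⊔ U) k) :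
    ∃ a ∈ gradePiece U k, ∃ b ∈ gradePiece U (k - 1), ∃ c ∈ gradePiece U (k - 1),
      ∃ t ∈ gradePiece U (k - 2), z = a + ι F e * b + ι F f * c + ι F e * (ι F f * t) := by
  rw [gradePiece_eq_span] at hz
  induction hz using Submodule.span_induction with
  | mem w hw =>
    obtain ⟨l, hl, rfl, rfl⟩ := hw
    induction l with
    | nil =>
      refine ⟨1, ?_, 0, zero_mem _, 0, zero_mem _, 0, zero_mem _, by simp⟩
      exact wedge_mem_gradePiece (l := []) (by simp)
    | cons x l ih =>
      simp only [List.forall_mem_cons] at hl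
      obtain ⟨a, ha, b, hb, c, hc, t, ht, h⟩ := ih hl.2
      obtain ⟨y, hy, u, hu, rfl⟩ := Submodule.mem_sup.mp hl.1
      obtain ⟨α, β, rfl⟩ := Submodule.mem_span_pair.mp hy
      have e1 : ((((α • e + β • f + u) :: l).length : ℕ) : ℤ) = (l.length : ℤ) + 1 := by simp
      rw [e1]
      refine ⟨ι F u * a, ι_mul_mem_gradePiece hu (by simpa using ha),
        α • a - ι F u * b, sub_mem (Submodule.smul_mem _ _ (by simpa using ha))
          (ι_mul_mem_gradePiece hu (by simpa using hb)),
        β • a - ι F u * c, sub_mem (Submodule.smul_mem _ _ (by simpa using ha))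
          (ι_mul_mem_gradePiece hu (by simpa using hc)),
        α • c - β • b + ι F u * t, add_mem (sub_mem (Submodule.smul_mem _ _ ?_)
          (Submodule.smul_mem _ _ ?_)) (ι_mul_mem_gradePiece hu ?_), ?_⟩
      · convert hc using 1; ring_nf
      · convert hb using 1; ring_nf
      · convert ht using 1; ring_nf
      · rw [wedge_cons, h]
        simp only [map_add, map_smul, add_mul, mul_add, mul_sub, smul_mul_assoc, mul_smul_comm,
          ι_mul_ι_mul_self, ι_mul_ι_mul_swap f e, ι_mul_ι_mul_swap u e, ι_mul_ι_mul_swap u f,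
          mul_neg, mul_zero, neg_zero, smul_neg, smul_zero]
        abel
  | zero => exact ⟨0, zero_mem _, 0, zero_mem _, 0, zero_mem _, 0, zero_mem _, by simp⟩
  | add x y _ _ hx hy =>
    obtain ⟨a, ha, b, hb, c, hc, t, ht, rfl⟩ := hx
    obtain ⟨a', ha', b', hb', c', hc', t', ht', rfl⟩ := hy
    refine ⟨_, add_mem ha ha', _, add_mem hb hb', _, add_mem hc hc', _, add_mem ht ht', ?_⟩
    simp only [mul_add]
    abel
  | smul r x _ hx =>
    obtain ⟨a, ha, b, hb, c, hc, t, ht, rfl⟩ := hx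
    refine ⟨_, Submodule.smul_mem _ r ha, _, Submodule.smul_mem _ r hb, _,
      Submodule.smul_mem _ r hc, _, Submodule.smul_mem _ r ht, ?_⟩
    simp only [mul_smul_comm, smul_add]

end DualPair

/-! ### Divided powers of the contraction with an alternating form -/

section Hyperbolic

variable (ω : LinearMap.BilinForm F V)

/-- The span of `R` and a list of pairs of vectors. -/
def hyperbolicSpan (R : Submodule F V) : List (V × V) → Submodule F V
  | [] => R
  | p :: hs => Submodule.span F {p.1, p.2} ⊔ hyperbolicSpan R hs

/-- The list consists of mutually orthogonal hyperbolic pairs, orthogonal to the totally isotropic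
subspace `R`. -/
def IsHyperbolic (R : Submodule F V) : List (V × V) → Prop
  | [] => ∀ x ∈ R, ∀ y ∈ R, ω x y = 0
  | p :: hs => ω p.1 p.2 = 1 ∧ (∀ u ∈ hyperbolicSpan R hs, ω p.1 u = 0 ∧ ω p.2 u = 0) ∧
      IsHyperbolic R hs

/-- The double contraction attached to a hyperbolic pair. -/
noncomputable def contractPair (p : V × V) : ExteriorAlgebra F V →ₗ[F] ExteriorAlgebra F V :=
  contract (ω p.1) ∘ₗ contract (LinearMap.flip ω p.2)

/-- The elementary symmetric polynomials in the double contractions attached to a list of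
hyperbolic pairs, that is, the divided powers of the contraction with the form. -/
noncomputable def dividedContraction :
    List (V × V) → ℕ → ExteriorAlgebra F V →ₗ[F] ExteriorAlgebra F V
  | _, 0 => LinearMap.id
  | [], _ + 1 => 0
  | p :: hs, s + 1 => dividedContraction hs (s + 1) + contractPair ω p ∘ₗ dividedContraction hs s

@[simp] lemma dividedContraction_zero (hs : List (V × V)) :
    dividedContraction ω hs 0 = LinearMap.id := by
  cases hs <;> rfl

lemma dividedContraction_cons (p : V × V) (hs : List (V × V)) (s : ℕ)
    (z : ExteriorAlgebra F V) : dividedContraction ω (p :: hs) (s + 1) z =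
      dividedContraction ω hs (s + 1) z + contractPair ω p (dividedContraction ω hs s z) := rfl

lemma contractPair_contract (p : V × V) (d : Dual F V) (z : ExteriorAlgebra F V) :
    contractPair ω p (contract d z) = contract d (contractPair ω p z) := by
  simp only [contractPair, LinearMap.comp_apply]
  rw [contract_comm _ d, map_neg, contract_comm _ d, neg_neg]

lemma dividedContraction_contract (hs : List (V × V)) (s : ℕ) (d : Dual F V)
    (z : ExteriorAlgebra F V) :
    dividedContraction ω hs s (contract d z) = contract d (dividedContraction ω hs s z) := by
  induction hs generalizing s with
  | nil => cases s <;> simp [dividedContraction]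
  | cons p hs ih =>
    cases s with
    | zero => simp
    | succ s => simp only [dividedContraction_cons, ih, contractPair_contract, map_add]

lemma dividedContraction_contractPair (hs : List (V × V)) (s : ℕ) (p : V × V)
    (z : ExteriorAlgebra F V) : dividedContraction ω hs s (contractPair ω p z) =
      contractPair ω p (dividedContraction ω hs s z) := by
  simp only [contractPair, LinearMap.comp_apply, dividedContraction_contract]

/-- The functional which equals `ω y` for a vector `y` of the hyperbolic span. -/
def hyperbolicDual : List (V × V) → V →ₗ[F] Dual F V
  | [] => 0
  | p :: hs => (LinearMap.flip ω p.2).smulRight (ω p.1) -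
      (ω p.1).smulRight (LinearMap.flip ω p.2) + hyperbolicDual hs

lemma hyperbolicDual_cons (p : V × V) (hs : List (V × V)) (y : V) :
    hyperbolicDual ω (p :: hs) y =
      (ω y p.2 • ω p.1 - ω p.1 y • LinearMap.flip ω p.2) + hyperbolicDual ω hs y := rfl

lemma contractPair_ι_mul (p : V × V) (y : V) (z : ExteriorAlgebra F V) :
    contractPair ω p (ι F y * z) = ι F y * contractPair ω p z +
      contract (ω y p.2 • ω p.1 - ω p.1 y • LinearMap.flip ω p.2) z := by
  simp only [contractPair, LinearMap.comp_apply, contract_ι_mul, map_sub, map_smul, contract_sub,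
    contract_smul, LinearMap.sub_apply, LinearMap.smul_apply, LinearMap.flip_apply]
  abel

/-- Each of the two functionals already occurs in `contractPair ω p`, and contracting twice by the
same functional gives zero. -/
lemma contract_hyperbolicDual_contractPair (p : V × V) (α β : F) (z : ExteriorAlgebra F V) :
    contract (α • ω p.1 - β • LinearMap.flip ω p.2) (contractPair ω p z) = 0 := by
  simp only [contractPair, LinearMap.comp_apply, contract_sub, contract_smul,
    LinearMap.sub_apply, LinearMap.smul_apply, contract_contract]
  rw [contract_comm (LinearMap.flip ω p.2), contract_contract]
  simp

/-- Leibniz rule for divided powers: the commutator of the contraction `D` with `y ∧ ·` is the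
contraction by a functional, which commutes with `D`. Hence commuting the divided power of order `s
+ 1` past `y` costs that functional times the divided power of order `s`, without division by
integers. -/
lemma dividedContraction_ι_mul (hs : List (V × V)) (s : ℕ) (y : V) (z : ExteriorAlgebra F V) :
    dividedContraction ω hs (s + 1) (ι F y * z) = ι F y * dividedContraction ω hs (s + 1) z +
      contract (hyperbolicDual ω hs y) (dividedContraction ω hs s z) := by
  induction hs generalizing s with
  | nil => simp [dividedContraction, hyperbolicDual, contract_zero]
  | cons p hs ih =>
    rw [dividedContraction_cons, dividedContraction_cons, ih, hyperbolicDual_cons, contract_add,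
      LinearMap.add_apply]
    cases s with
    | zero =>
      simp only [dividedContraction_zero, LinearMap.id_apply, contractPair_ι_mul, mul_add]
      abel
    | succ s =>
      rw [ih, dividedContraction_cons]
      simp only [map_add, contractPair_ι_mul, contract_hyperbolicDual_contractPair,
        contractPair_contract, mul_add]
      abel

/-- The part of `⋀^k U` killed by all divided contractions of order at least `j`. -/
noncomputable def contractionKernel (R : Submodule F V) (hs : List (V × V)) (j : ℕ) (k : ℤ) :
    Submodule F (ExteriorAlgebra F V) :=
  gradePiece (hyperbolicSpan R hs) k ⊓ ⨅ s ≥ j, LinearMap.ker (dividedContraction ω hs s)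

lemma mem_contractionKernel {R : Submodule F V} {hs : List (V × V)} {j : ℕ} {k : ℤ}
    {z : ExteriorAlgebra F V} : z ∈ contractionKernel ω R hs j k ↔
      z ∈ gradePiece (hyperbolicSpan R hs) k ∧ ∀ s ≥ j, dividedContraction ω hs s z = 0 := by
  simp [contractionKernel, Submodule.mem_iInf]

variable {ω}

lemma IsHyperbolic.dualPair (hω : ω.IsAlt) {R : Submodule F V} {p : V × V} {hs : List (V × V)}
    (h : IsHyperbolic ω R (p :: hs)) : DualPair p.1 p.2 (LinearMap.flip ω p.2) (ω p.1) :=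
  ⟨h.1, hω _, hω _, h.1⟩

lemma IsHyperbolic.vanish (hω : ω.IsAlt) {R : Submodule F V} {p : V × V} {hs : List (V × V)}
    (h : IsHyperbolic ω R (p :: hs)) (u : V) (hu : u ∈ hyperbolicSpan R hs) :
    LinearMap.flip ω p.2 u = 0 ∧ ω p.1 u = 0 := by
  refine ⟨?_, (h.2.1 u hu).1⟩
  rw [LinearMap.flip_apply, ← LinearMap.IsAlt.neg hω p.2 u, (h.2.1 u hu).2, neg_zero]

lemma mem_hyperbolicSpan_cons {R : Submodule F V} {p : V × V} {hs : List (V × V)} {x : V}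
    (hx : x ∈ hyperbolicSpan R (p :: hs)) :
    ∃ α β : F, ∃ u ∈ hyperbolicSpan R hs, x = α • p.1 + β • p.2 + u := by
  obtain ⟨y, hy, u, hu, rfl⟩ := Submodule.mem_sup.mp hx
  obtain ⟨α, β, rfl⟩ := Submodule.mem_span_pair.mp hy
  exact ⟨α, β, u, hu, rfl⟩

lemma fst_mem_hyperbolicSpan (R : Submodule F V) (p : V × V) (hs : List (V × V)) :
    p.1 ∈ hyperbolicSpan R (p :: hs) :=
  Submodule.mem_sup_left (Submodule.subset_span (by simp))

lemma snd_mem_hyperbolicSpan (R : Submodule F V) (p : V × V) (hs : List (V × V)) :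
    p.2 ∈ hyperbolicSpan R (p :: hs) :=
  Submodule.mem_sup_left (Submodule.subset_span (by simp))

lemma hyperbolicSpan_le_cons (R : Submodule F V) (p : V × V) (hs : List (V × V)) :
    hyperbolicSpan R hs ≤ hyperbolicSpan R (p :: hs) := le_sup_right

lemma hyperbolicDual_eq_zero (hω : ω.IsAlt) {R : Submodule F V} {hs : List (V × V)} {y : V}
    (hy : ∀ u ∈ hyperbolicSpan R hs, ω y u = 0) :
    hyperbolicDual ω hs y = 0 ∧ ∀ z, hyperbolicDual ω hs z y = 0 := by
  induction hs with
  | nil => simp [hyperbolicDual]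
  | cons p hs ih =>
    have h0 := ih fun u hu => hy u (hyperbolicSpan_le_cons R p hs hu)
    have h1 := hy _ (fst_mem_hyperbolicSpan R p hs)
    have h2 := hy _ (snd_mem_hyperbolicSpan R p hs)
    have h1' : ω p.1 y = 0 := by rw [← LinearMap.IsAlt.neg hω, h1, neg_zero]
    refine ⟨?_, fun z => ?_⟩
    · rw [hyperbolicDual_cons, h0.1, h2, h1']
      simp
    · rw [hyperbolicDual_cons, LinearMap.add_apply, h0.2]
      simp [h2, h1']

lemma hyperbolicDual_apply (hω : ω.IsAlt) {R : Submodule F V} {hs : List (V × V)}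
    (h : IsHyperbolic ω R hs) {x y : V} (hx : x ∈ hyperbolicSpan R hs)
    (hy : y ∈ hyperbolicSpan R hs) : hyperbolicDual ω hs y x = ω y x := by
  induction hs generalizing x y with
  | nil => exact (h y hy x hx).symm
  | cons p hs ih =>
    have h2 : ω p.2 p.1 = -1 := by rw [← LinearMap.IsAlt.neg hω, h.1]
    obtain ⟨α, β, u, hu, rfl⟩ := mem_hyperbolicSpan_cons hx
    obtain ⟨α', β', u', hu', rfl⟩ := mem_hyperbolicSpan_cons hy
    have e1 := hyperbolicDual_eq_zero hω fun u hu => (h.2.1 u hu).1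
    have e2 := hyperbolicDual_eq_zero hω fun u hu => (h.2.1 u hu).2
    have a1 := (h.2.1 u hu).1
    have a2 := (h.2.1 u hu).2
    have b1 := (h.2.1 u' hu').1
    have b2 := (h.2.1 u' hu').2
    have c1 : ω u p.2 = 0 := by rw [← LinearMap.IsAlt.neg hω, a2, neg_zero]
    have c2 : ω u' p.2 = 0 := by rw [← LinearMap.IsAlt.neg hω, b2, neg_zero]
    have c3 : ω u' p.1 = 0 := by rw [← LinearMap.IsAlt.neg hω, b1, neg_zero]
    rw [hyperbolicDual_cons]
    simp only [map_add, map_smul, LinearMap.add_apply, LinearMap.smul_apply, LinearMap.sub_apply,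
      LinearMap.flip_apply, e1.1, e1.2, e2.1, e2.2, a1, a2, b1, c1, c2, c3, ih h.2.2 hu hu',
      smul_eq_mul, h.1, h2, hω p.1, hω p.2, LinearMap.zero_apply]
    ring

end Hyperbolic

end ExteriorAlgebra

namespace ExteriorAlgebra

variable {F : Type u} [Field F] {V : Type v} [AddCommGroup V] [Module F V]
  {ω : LinearMap.BilinForm F V}

/-! ### Upper bound: the kernel of the divided contractions -/

section Upper

lemma dividedContraction_ι_mul_of_orthogonal (hω : ω.IsAlt) {R : Submodule F V}
    {hs : List (V × V)} {y : V} (hy : ∀ u ∈ hyperbolicSpan R hs, ω y u = 0) (s : ℕ)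
    (z : ExteriorAlgebra F V) :
    dividedContraction ω hs s (ι F y * z) = ι F y * dividedContraction ω hs s z := by
  cases s with
  | zero => simp
  | succ s =>
    rw [dividedContraction_ι_mul, (hyperbolicDual_eq_zero hω hy).1, contract_zero]
    simp

lemma Free.dividedContraction {d₁ d₂ : Dual F V} {a : ExteriorAlgebra F V} (ha : Free d₁ d₂ a)
    (hs : List (V × V)) (s : ℕ) : Free d₁ d₂ (dividedContraction ω hs s a) := by
  constructor
  · rw [← dividedContraction_contract, ha.1, map_zero]
  · rw [← dividedContraction_contract, ha.2, map_zero]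

lemma contractionKernel_zero (R : Submodule F V) (hs : List (V × V)) (k : ℤ) :
    contractionKernel ω R hs 0 k = ⊥ := by
  rw [eq_bot_iff]
  intro z hz
  rw [mem_contractionKernel] at hz
  simpa using hz.2 0 le_rfl

variable {R : Submodule F V} {p : V × V} {hs : List (V × V)}

/-- The action of the divided contractions on the components of an element. -/
lemma dividedContraction_cons_components (hω : ω.IsAlt) (h : IsHyperbolic ω R (p :: hs))
    {a b c t : ExteriorAlgebra F V} (ha : Free (LinearMap.flip ω p.2) (ω p.1) a)
    (hb : Free (LinearMap.flip ω p.2) (ω p.1) b) (hc : Free (LinearMap.flip ω p.2) (ω p.1) c)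
    (ht : Free (LinearMap.flip ω p.2) (ω p.1) t) (s : ℕ) :
    dividedContraction ω (p :: hs) (s + 1)
        (a + ι F p.1 * b + ι F p.2 * c + ι F p.1 * (ι F p.2 * t)) =
      (dividedContraction ω hs (s + 1) a + dividedContraction ω hs s t) +
        ι F p.1 * dividedContraction ω hs (s + 1) b + ι F p.2 * dividedContraction ω hs (s + 1) c +
        ι F p.1 * (ι F p.2 * dividedContraction ω hs (s + 1) t) := by
  have h1 := fun u hu => (h.2.1 u hu).1
  have h2 := fun u hu => (h.2.1 u hu).2
  rw [dividedContraction_cons, ← dividedContraction_contractPair, contractPair,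
    LinearMap.comp_apply, (h.dualPair hω).contract₂₁ ha hb hc ht]
  simp only [map_add, dividedContraction_ι_mul_of_orthogonal hω h1,
    dividedContraction_ι_mul_of_orthogonal hω h2]
  abel

/-- Write `z = a + e ∧ b + f ∧ c + e ∧ f ∧ t`. In order `s + 1` only the component free of `e` and
`f` mixes two terms, the order `s + 1` image of `a` and the order `s` image of `t`. This shifts the
order to `j + 2` for `a` and to `j` for `t`, while `b` and `c` keep `j + 1`. -/
lemma finrank_contractionKernel_cons [FiniteDimensional F V] (hω : ω.IsAlt)
    (h : IsHyperbolic ω R (p :: hs)) (j : ℕ) (k : ℤ) :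
    finrank F (contractionKernel ω R (p :: hs) (j + 1) k) ≤
      finrank F (contractionKernel ω R hs (j + 2) k) +
      finrank F (contractionKernel ω R hs j (k - 2)) +
      2 * finrank F (contractionKernel ω R hs (j + 1) (k - 1)) := by
  have hd := h.dualPair hω
  have key : ∀ z ∈ contractionKernel ω R (p :: hs) (j + 1) k, ∃ a b c t : ExteriorAlgebra F V,
      a ∈ contractionKernel ω R hs (j + 2) k ∧
      (a = 0 → t ∈ contractionKernel ω R hs j (k - 2)) ∧
      b ∈ contractionKernel ω R hs (j + 1) (k - 1) ∧
      c ∈ contractionKernel ω R hs (j + 1) (k - 1) ∧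
      killPair p.1 p.2 (LinearMap.flip ω p.2) (ω p.1) z = a ∧
      contract (ω p.1) (contract (LinearMap.flip ω p.2) z) = t ∧
      contract (LinearMap.flip ω p.2) z = b + ι F p.2 * t ∧
      contract (ω p.1) z = c - ι F p.1 * t ∧
      z = a + ι F p.1 * b + ι F p.2 * c + ι F p.1 * (ι F p.2 * t) := by
    intro z hz
    rw [mem_contractionKernel] at hz
    obtain ⟨a, ha, b, hb, c, hc, t, ht, rfl⟩ := exists_of_mem_gradePiece_sup _ _ _ hz.1
    have fa := free_of_mem_gradePiece (h.vanish hω) ha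
    have fb := free_of_mem_gradePiece (h.vanish hω) hb
    have fc := free_of_mem_gradePiece (h.vanish hω) hc
    have ft := free_of_mem_gradePiece (h.vanish hω) ht
    have hz' : ∀ s ≥ j, dividedContraction ω hs (s + 1) a + dividedContraction ω hs s t = 0 ∧
        dividedContraction ω hs (s + 1) b = 0 ∧ dividedContraction ω hs (s + 1) c = 0 ∧
        dividedContraction ω hs (s + 1) t = 0 := by
      intro s hs'
      have e := hz.2 (s + 1) (by omega)
      rw [dividedContraction_cons_components hω h fa fb fc ft] at e
      have f1 : Free (LinearMap.flip ω p.2) (ω p.1)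
          (dividedContraction ω hs (s + 1) a + dividedContraction ω hs s t) := by
        have x1 := fa.dividedContraction (ω := ω) hs (s + 1)
        have x2 := ft.dividedContraction (ω := ω) hs s
        exact ⟨by rw [map_add, x1.1, x2.1, add_zero], by rw [map_add, x1.2, x2.2, add_zero]⟩
      have f2 := fb.dividedContraction (ω := ω) hs (s + 1)
      have f3 := fc.dividedContraction (ω := ω) hs (s + 1)
      have f4 := ft.dividedContraction (ω := ω) hs (s + 1)
      have e1 := hd.killPair_apply f1 f2 f3 f4
      have e2 := hd.contract₂₁ f1 f2 f3 f4
      have e3 := hd.contract₁ f1 f2 f3 f4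
      have e4 := hd.contract₂ f1 f2 f3 f4
      rw [e, map_zero] at e1 e3 e4
      rw [e, map_zero, map_zero] at e2
      rw [← e2, mul_zero, add_zero] at e3
      rw [← e2, mul_zero, sub_zero] at e4
      exact ⟨e1.symm, e3.symm, e4.symm, e2.symm⟩
    refine ⟨a, b, c, t, ?_, ?_, ?_, ?_, hd.killPair_apply fa fb fc ft, hd.contract₂₁ fa fb fc ft,
      hd.contract₁ fa fb fc ft, hd.contract₂ fa fb fc ft, rfl⟩
    · rw [mem_contractionKernel]
      refine ⟨ha, fun s hs' => ?_⟩
      -- In orders `j + 2` and higher the contribution of `t` has already vanished, so `a` is killed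
      -- by itself.
      obtain ⟨s, rfl⟩ : ∃ r, s = r + 2 := ⟨s - 2, by omega⟩
      have := (hz' (s + 1) (by omega)).1
      rwa [(hz' s (by omega)).2.2.2, add_zero] at this
    · rintro rfl
      rw [mem_contractionKernel]
      refine ⟨ht, fun s hs' => ?_⟩
      have := (hz' s hs').1
      rwa [map_zero, zero_add] at this
    · rw [mem_contractionKernel]
      refine ⟨hb, fun s hs' => ?_⟩
      obtain ⟨s, rfl⟩ : ∃ r, s = r + 1 := ⟨s - 1, by omega⟩
      exact (hz' s (by omega)).2.1
    · rw [mem_contractionKernel]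
      refine ⟨hc, fun s hs' => ?_⟩
      obtain ⟨s, rfl⟩ : ∃ r, s = r + 1 := ⟨s - 1, by omega⟩
      exact (hz' s (by omega)).2.2.1
  set K := contractionKernel ω R (p :: hs) (j + 1) k with hK
  -- The maps read off `a`, `t`, `b`, `c` in this order: `t` is known to be killed from order `j` on
  -- only when `a = 0`, and `φ₃`, `φ₄` return `b`, `c` only when `t = 0`.
  let φ₁ := killPair p.1 p.2 (LinearMap.flip ω p.2) (ω p.1)
  let φ₂ := contract (ω p.1) ∘ₗ contract (LinearMap.flip ω p.2)
  let φ₃ := contract (LinearMap.flip ω p.2)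
  let φ₄ := contract (ω p.1)
  have s1 := Submodule.finrank_le_of_map_le φ₁ (M := K)
    (N := contractionKernel ω R hs (j + 2) k) (by
      rintro _ ⟨z, hz, rfl⟩
      obtain ⟨a, b, c, t, ha, ht, hb, hc, e1, e2, e3, e4, e⟩ := key z hz
      rwa [← e1] at ha)
  have s2 := Submodule.finrank_le_of_map_le φ₂ (M := K ⊓ LinearMap.ker φ₁)
    (N := contractionKernel ω R hs j (k - 2)) (by
      rintro _ ⟨z, ⟨hz, hz1⟩, rfl⟩
      obtain ⟨a, b, c, t, ha, ht, hb, hc, e1, e2, e3, e4, e⟩ := key z hz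
      have h0 : a = 0 := e1.symm.trans hz1
      have := ht h0
      rwa [← e2] at this)
  have s3 := Submodule.finrank_le_of_map_le φ₃ (M := K ⊓ LinearMap.ker φ₁ ⊓ LinearMap.ker φ₂)
    (N := contractionKernel ω R hs (j + 1) (k - 1)) (by
      rintro _ ⟨z, ⟨⟨hz, hz1⟩, hz2⟩, rfl⟩
      obtain ⟨a, b, c, t, ha, ht, hb, hc, e1, e2, e3, e4, e⟩ := key z hz
      have h1 : t = 0 := e2.symm.trans hz2
      rw [h1, mul_zero, add_zero] at e3
      rwa [← e3] at hb)
  have s4 := Submodule.finrank_le_of_map_le φ₄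
    (M := K ⊓ LinearMap.ker φ₁ ⊓ LinearMap.ker φ₂ ⊓ LinearMap.ker φ₃)
    (N := contractionKernel ω R hs (j + 1) (k - 1)) (by
      rintro _ ⟨z, ⟨⟨⟨hz, hz1⟩, hz2⟩, hz3⟩, rfl⟩
      obtain ⟨a, b, c, t, ha, ht, hb, hc, e1, e2, e3, e4, e⟩ := key z hz
      have h1 : t = 0 := e2.symm.trans hz2
      rw [h1, mul_zero, sub_zero] at e4
      rwa [← e4] at hc)
  have s5 : K ⊓ LinearMap.ker φ₁ ⊓ LinearMap.ker φ₂ ⊓ LinearMap.ker φ₃ ⊓ LinearMap.ker φ₄ = ⊥ := by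
    rw [eq_bot_iff]
    rintro z ⟨⟨⟨⟨hz, hz1⟩, hz2⟩, hz3⟩, hz4⟩
    obtain ⟨a, b, c, t, ha, ht, hb, hc, e1, e2, e3, e4, e⟩ := key z hz
    have h0 : a = 0 := e1.symm.trans hz1
    have h1 : t = 0 := e2.symm.trans hz2
    rw [h1, mul_zero, add_zero] at e3
    rw [h1, mul_zero, sub_zero] at e4
    have h2 : b = 0 := e3.symm.trans hz3
    have h3 : c = 0 := e4.symm.trans hz4
    simp [e, h0, h1, h2, h3]
  rw [s5, finrank_bot] at s4
  omega

end Upper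

lemma binomial_succ (m : ℕ) (k : ℤ) : binomial (m + 1) k = binomial m k + binomial m (k - 1) := by
  rcases lt_or_ge k 0 with hk | hk
  · rw [binomial, binomial, binomial, if_neg (by omega), if_neg (by omega), if_neg (by omega)]
    rfl
  obtain ⟨k, rfl⟩ := Int.eq_ofNat_of_zero_le hk
  cases k with
  | zero => simp [binomial]
  | succ k =>
    have : ((k + 1 : ℕ) : ℤ) - 1 = k := by simp
    rw [this]
    simp [binomial, Nat.choose_succ_succ, add_comm]
    rw [if_pos (by omega), if_pos (by omega)]

lemma binomial_add_two (m : ℕ) (k : ℤ) :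
    binomial (m + 2) k = binomial m k + 2 * binomial m (k - 1) + binomial m (k - 2) := by
  rw [binomial_succ (m + 1), binomial_succ, binomial_succ, sub_sub]
  norm_num
  ring

lemma binomial_of_neg (m : ℕ) {k : ℤ} (hk : k < 0) : binomial m k = 0 := by
  rw [binomial, if_neg (by omega)]

lemma binomial_nonneg (m : ℕ) (k : ℤ) : 0 ≤ binomial m k := by
  unfold binomial
  split_ifs <;> omega

/-- The condition on `k` passes unchanged to the three smaller cases. With no pair left and `j ≥ 1`
it gives `k < 2 * j`, so the subtracted binomial is zero; without it that base case can fail. -/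
theorem finrank_contractionKernel_le [FiniteDimensional F V] (hω : ω.IsAlt) {R : Submodule F V}
    {hs : List (V × V)} (h : IsHyperbolic ω R hs) (j : ℕ) (k : ℤ) (hk : k ≤ hs.length + j) :
    (finrank F (contractionKernel ω R hs j k) : ℤ) ≤
      binomial (2 * hs.length + finrank F R) k -
        binomial (2 * hs.length + finrank F R) (k - 2 * j) := by
  induction hs generalizing j k with
  | nil =>
    cases j with
    | zero => simp [contractionKernel_zero]
    | succ j =>
      have h1 : finrank F (contractionKernel ω R [] (j + 1) k) ≤ finrank F (gradePiece R k) :=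
        Submodule.finrank_mono inf_le_left
      have h2 := finrank_gradePiece R k
      rw [binomial_of_neg (k := k - 2 * ((j + 1 : ℕ) : ℤ)) _ (by simp at hk; push_cast; omega)]
      simp
      omega
  | cons p hs ih =>
    cases j with
    | zero => simp [contractionKernel_zero]
    | succ j =>
      have h1 := finrank_contractionKernel_cons hω h j k
      simp only [List.length_cons] at hk ⊢
      have i1 := ih h.2.2 (j + 2) k (by push_cast at hk ⊢; omega)
      have i2 := ih h.2.2 j (k - 2) (by push_cast at hk ⊢; omega)
      have i3 := ih h.2.2 (j + 1) (k - 1) (by push_cast at hk ⊢; omega)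
      have e : 2 * (hs.length + 1) + finrank F R = (2 * hs.length + finrank F R) + 2 := by ring
      rw [e, binomial_add_two, binomial_add_two]
      push_cast at *
      have g1 : k - 2 * ((j : ℤ) + 1) - 2 = k - 2 * (j + 2) := by ring
      have g2 : k - 2 * ((j : ℤ) + 1) - 1 = k - 1 - 2 * (j + 1) := by ring
      have g3 : k - 2 * ((j : ℤ) + 1) = k - 2 - 2 * j := by ring
      rw [g1, g2, g3]
      omega

end ExteriorAlgebra

namespace ExteriorAlgebra

variable {F : Type u} [Field F] {V : Type v} [AddCommGroup V] [Module F V]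

/-! ### Lower bound: products of few pairs with an isotropic product -/

section Lower

/-- The product `(a₁ ∧ b₁) ∧ ⋯ ∧ (a_r ∧ b_r)` of a list of pairs of vectors. -/
noncomputable def pairWedge (F : Type u) [Field F] {V : Type v} [AddCommGroup V] [Module F V]
    (ps : List (V × V)) : ExteriorAlgebra F V :=
  (ps.map fun p => ι F p.1 * ι F p.2).prod

@[simp] lemma pairWedge_nil : pairWedge F ([] : List (V × V)) = 1 := rfl

@[simp] lemma pairWedge_cons (p : V × V) (ps : List (V × V)) :
    pairWedge F (p :: ps) = ι F p.1 * ι F p.2 * pairWedge F ps := by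
  simp [pairWedge]

lemma commute_pairWedge (ps : List (V × V)) (z : ExteriorAlgebra F V) :
    Commute (pairWedge F ps) z := by
  induction ps with
  | nil => exact Commute.one_left z
  | cons p ps ih =>
    rw [pairWedge_cons]
    exact (commute_ι_mul_ι _ _ z).mul_left ih

lemma pairWedge_mul_ι_mul (ps : List (V × V)) (x : V) (z : ExteriorAlgebra F V) :
    pairWedge F ps * (ι F x * z) = ι F x * (pairWedge F ps * z) := by
  rw [← mul_assoc, (commute_pairWedge ps (ι F x)).eq, mul_assoc]

/-- The vectors lie in `U` and are mutually orthogonal, except within the pairs. -/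
structure PairConfig (ω : LinearMap.BilinForm F V) (U : Submodule F V) (ps : List (V × V))
    (ys : List V) : Prop where
  iso : ∀ x ∈ ys, ∀ y ∈ ys, ω x y = 0
  cross : ∀ p ∈ ps, ∀ y ∈ ys, ω p.1 y = 0 ∧ ω p.2 y = 0
  pair : ps.Pairwise fun p q => ω p.1 q.1 = 0 ∧ ω p.1 q.2 = 0 ∧ ω p.2 q.1 = 0 ∧ ω p.2 q.2 = 0
  mem_pair : ∀ p ∈ ps, p.1 ∈ U ∧ p.2 ∈ U
  mem : ∀ y ∈ ys, y ∈ U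

/-- The span of the products of at most `j - 1` pairs with an isotropic product, of total
degree `k`, where all vectors are orthogonal except within the pairs. -/
noncomputable def pairSpan (ω : LinearMap.BilinForm F V) (U : Submodule F V) (j : ℕ) (k : ℤ) :
    Submodule F (ExteriorAlgebra F V) :=
  Submodule.span F {w | ∃ (ps : List (V × V)) (ys : List V), PairConfig ω U ps ys ∧
    ps.length < j ∧ 2 * (ps.length : ℤ) + ys.length = k ∧ w = pairWedge F ps * wedge F ys}

variable {ω : LinearMap.BilinForm F V} {U : Submodule F V}

lemma PairConfig.mem_pairSpan {ps : List (V × V)} {ys : List V} (h : PairConfig ω U ps ys) {j : ℕ}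
    (hj : ps.length < j) {k : ℤ} (hk : 2 * (ps.length : ℤ) + ys.length = k) :
    pairWedge F ps * wedge F ys ∈ pairSpan ω U j k :=
  Submodule.subset_span ⟨ps, ys, h, hj, hk, rfl⟩

lemma PairConfig.mono {ps : List (V × V)} {ys : List V} (h : PairConfig ω U ps ys)
    {U' : Submodule F V} (hU : U ≤ U') : PairConfig ω U' ps ys :=
  ⟨h.iso, h.cross, h.pair, fun p hp => ⟨hU (h.mem_pair p hp).1, hU (h.mem_pair p hp).2⟩,
    fun y hy => hU (h.mem y hy)⟩

lemma PairConfig.cons (hω : ω.IsAlt) {ps : List (V × V)} {ys : List V}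
    (h : PairConfig ω U ps ys) {e : V} (he : e ∈ U) (h1 : ∀ p ∈ ps, ω e p.1 = 0 ∧ ω e p.2 = 0)
    (h2 : ∀ y ∈ ys, ω e y = 0) : PairConfig ω U ps (e :: ys) := by
  refine ⟨?_, ?_, h.pair, h.mem_pair, by simpa using ⟨he, h.mem⟩⟩
  · simp only [List.forall_mem_cons]
    refine ⟨⟨hω e, h2⟩, fun x hx => ⟨?_, h.iso x hx⟩⟩
    rw [← LinearMap.IsAlt.neg hω, h2 x hx, neg_zero]
  · intro p hp
    simp only [List.forall_mem_cons]
    refine ⟨⟨?_, ?_⟩, h.cross p hp⟩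
    · rw [← LinearMap.IsAlt.neg hω, (h1 p hp).1, neg_zero]
    · rw [← LinearMap.IsAlt.neg hω, (h1 p hp).2, neg_zero]

lemma PairConfig.cons_pair {ps : List (V × V)} {ys : List V}
    (h : PairConfig ω U ps ys) {e f : V} (he : e ∈ U) (hf : f ∈ U)
    (h1 : ∀ u ∈ ps, (ω e u.1 = 0 ∧ ω e u.2 = 0) ∧ (ω f u.1 = 0 ∧ ω f u.2 = 0))
    (h2 : ∀ y ∈ ys, ω e y = 0 ∧ ω f y = 0) : PairConfig ω U ((e, f) :: ps) ys := by
  refine ⟨h.iso, ?_, ?_, ?_, h.mem⟩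
  · simp only [List.forall_mem_cons]
    exact ⟨h2, h.cross⟩
  · rw [List.pairwise_cons]
    exact ⟨fun q hq => ⟨(h1 q hq).1.1, (h1 q hq).1.2, (h1 q hq).2⟩, h.pair⟩
  · simp only [List.forall_mem_cons]
    exact ⟨⟨he, hf⟩, h.mem_pair⟩

lemma contract_pairWedge_mul_wedge_eq_zero {d : Dual F V} {ps : List (V × V)} {ys : List V}
    (h1 : ∀ p ∈ ps, d p.1 = 0 ∧ d p.2 = 0) (h2 : ∀ y ∈ ys, d y = 0) :
    contract d (pairWedge F ps * wedge F ys) = 0 := by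
  induction ps with
  | nil => rw [pairWedge_nil, one_mul]; exact contract_wedge_eq_zero h2
  | cons p ps ih =>
    simp only [List.forall_mem_cons] at h1
    rw [pairWedge_cons, mul_assoc, mul_assoc, contract_ι_mul, contract_ι_mul, ih h1.2, h1.1.1,
      h1.1.2]
    simp

variable {R : Submodule F V} {p : V × V} {hs : List (V × V)}

lemma PairConfig.free (hω : ω.IsAlt) (h : IsHyperbolic ω R (p :: hs)) {ps : List (V × V)}
    {ys : List V} (hc : PairConfig ω (hyperbolicSpan R hs) ps ys) :
    Free (LinearMap.flip ω p.2) (ω p.1) (pairWedge F ps * wedge F ys) := by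
  have hv := h.vanish hω
  exact ⟨contract_pairWedge_mul_wedge_eq_zero (fun q hq => ⟨(hv _ (hc.mem_pair q hq).1).1,
      (hv _ (hc.mem_pair q hq).2).1⟩) fun y hy => (hv _ (hc.mem y hy)).1,
    contract_pairWedge_mul_wedge_eq_zero (fun q hq => ⟨(hv _ (hc.mem_pair q hq).1).2,
      (hv _ (hc.mem_pair q hq).2).2⟩) fun y hy => (hv _ (hc.mem y hy)).2⟩

/-- Counterpart of `finrank_contractionKernel_cons`: here every possible component `a`, `t`, `b`,
`c` is lifted to an element of the larger span whose earlier components vanish. -/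
lemma finrank_pairSpan_cons [FiniteDimensional F V] (hω : ω.IsAlt)
    (h : IsHyperbolic ω R (p :: hs)) (j : ℕ) (k : ℤ) :
    finrank F (pairSpan ω (hyperbolicSpan R hs) (j + 2) k) +
      finrank F (pairSpan ω (hyperbolicSpan R hs) j (k - 2)) +
      2 * finrank F (pairSpan ω (hyperbolicSpan R hs) (j + 1) (k - 1)) ≤
    finrank F (pairSpan ω (hyperbolicSpan R (p :: hs)) (j + 1) k) := by
  have hd := h.dualPair hω
  have hle := hyperbolicSpan_le_cons R p hs
  have hp1 := fst_mem_hyperbolicSpan R p hs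
  have hp2 := snd_mem_hyperbolicSpan R p hs
  have hv := h.2.1
  set W := hyperbolicSpan R hs
  set S := pairSpan ω (hyperbolicSpan R (p :: hs)) (j + 1) k with hS
  let φ₁ := killPair p.1 p.2 (LinearMap.flip ω p.2) (ω p.1)
  let φ₂ := contract (ω p.1) ∘ₗ contract (LinearMap.flip ω p.2)
  let φ₃ := contract (LinearMap.flip ω p.2)
  let φ₄ := contract (ω p.1)
  have f0 : Free (LinearMap.flip ω p.2) (ω p.1) (0 : ExteriorAlgebra F V) := free_zero
  have s1 := Submodule.le_finrank_of_le_map φ₁ (M := S) (N := pairSpan ω W (j + 2) k) (by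
    rw [pairSpan, Submodule.span_le]
    rintro w ⟨ps, ys, hc, hj, hk, rfl⟩
    rcases lt_or_ge ps.length (j + 1) with hj' | hj'
    · refine ⟨_, (hc.mono hle).mem_pairSpan hj' hk, ?_⟩
      have f1 := hc.free hω h
      simpa using hd.killPair_apply f1 f0 f0 f0
    · cases ps with
      | nil => simp at hj'
      | cons q ps =>
        obtain ⟨a, b⟩ := q
        have hcr := hc.cross (a, b) (by simp)
        have hmp := hc.mem_pair (a, b) (by simp)
        have hpw := (List.pairwise_cons.mp hc.pair).1
        have hc0 : PairConfig ω W ps ys := ⟨hc.iso, fun p hp => hc.cross p (by simp [hp]),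
          (List.pairwise_cons.mp hc.pair).2, fun p hp => hc.mem_pair p (by simp [hp]), hc.mem⟩
        set c := ω a b
        have hva := hv a hmp.1
        have hvb := hv b hmp.2
        have hbe : ω b p.1 = 0 := by rw [← LinearMap.IsAlt.neg hω, hvb.1, neg_zero]
        have haf : ω a p.2 = 0 := by rw [← LinearMap.IsAlt.neg hω, hva.2, neg_zero]
        -- With `j + 1` pairs there is one too many. Writing `e, f` for the new hyperbolic pair, `a
        -- ∧ b` is replaced by `(a + e) ∧ (b - c f)`: these vectors are orthogonal because `ω a b -
        -- c * ω e f = 0`, and killing `e` and `f` returns `a ∧ b`.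
        have hc1 : PairConfig ω (hyperbolicSpan R (p :: hs)) ps
            ((a + p.1) :: (b - c • p.2) :: ys) := by
          refine ((hc0.mono hle).cons hω (sub_mem (hle hmp.2) (Submodule.smul_mem _ _ hp2))
            ?_ ?_).cons hω (add_mem (hle hmp.1) hp1) ?_ ?_
          · intro q hq
            have h1 := (hv _ (hc0.mem_pair q hq).1).2
            have h2 := (hv _ (hc0.mem_pair q hq).2).2
            have h3 := hpw q hq
            simp [h1, h2, h3]
          · intro y hy
            simp [(hcr y hy).2, (hv _ (hc0.mem y hy)).2]
          · intro q hq
            have h1 := (hv _ (hc0.mem_pair q hq).1).1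
            have h2 := (hv _ (hc0.mem_pair q hq).2).1
            have h3 := hpw q hq
            simp [h1, h2, h3]
          · simp only [List.forall_mem_cons]
            refine ⟨?_, fun y hy => ?_⟩
            · simp [hvb.1, haf, h.1, c]
            · simp [(hcr y hy).1, (hv _ (hc0.mem y hy)).1]
        refine ⟨_, hc1.mem_pairSpan (by simp at hj; omega)
          (by simp at hk ⊢; omega), ?_⟩
        have fa := hc.free hω h
        have hca : PairConfig ω W ps (a :: ys) := hc0.cons hω hmp.1
          (fun q hq => ⟨(hpw q hq).1, (hpw q hq).2.1⟩) fun y hy => (hcr y hy).1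
        have hcb : PairConfig ω W ps (b :: ys) := hc0.cons hω hmp.2
          (fun q hq => (hpw q hq).2.2) fun y hy => (hcr y hy).2
        have fb := hcb.free hω h
        have fc : Free (LinearMap.flip ω p.2) (ω p.1) (c • (pairWedge F ps * wedge F (a :: ys))) :=
          ⟨by rw [map_smul, (hca.free hω h).1, smul_zero],
            by rw [map_smul, (hca.free hω h).2, smul_zero]⟩
        have ft : Free (LinearMap.flip ω p.2) (ω p.1) (-(c • (pairWedge F ps * wedge F ys))) :=
          ⟨by rw [map_neg, map_smul, (hc0.free hω h).1, smul_zero, neg_zero],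
            by rw [map_neg, map_smul, (hc0.free hω h).2, smul_zero, neg_zero]⟩
        have := hd.killPair_apply fa fb fc ft
        refine Eq.trans (congrArg _ ?_) this
        simp only [wedge_cons, pairWedge_cons, map_add, map_sub, map_smul, add_mul, sub_mul,
          mul_add, mul_sub, smul_mul_assoc, mul_smul_comm, mul_neg, mul_assoc,
          pairWedge_mul_ι_mul, ι_mul_ι_mul_swap a p.2]
        module)
  have s2 := Submodule.le_finrank_of_le_map φ₂ (M := S ⊓ LinearMap.ker φ₁)
    (N := pairSpan ω W j (k - 2)) (by
      rw [pairSpan, Submodule.span_le]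
      rintro w ⟨ps, ys, hc, hj, hk, rfl⟩
      have hc1 : PairConfig ω (hyperbolicSpan R (p :: hs)) ((p.1, p.2) :: ps) ys :=
        (hc.mono hle).cons_pair hp1 hp2 (fun q hq => by
          have h1 := hv _ (hc.mem_pair q hq).1
          have h2 := hv _ (hc.mem_pair q hq).2
          exact ⟨⟨h1.1, h2.1⟩, h1.2, h2.2⟩) fun y hy => hv _ (hc.mem y hy)
      have f1 := hc.free hω h
      have e : pairWedge F ((p.1, p.2) :: ps) * wedge F ys =
          0 + ι F p.1 * 0 + ι F p.2 * 0 +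
            ι F p.1 * (ι F p.2 * (pairWedge F ps * wedge F ys)) := by
        simp [mul_assoc]
      refine ⟨_, ⟨hc1.mem_pairSpan (by simpa using hj) (by push_cast [List.length_cons]; omega), ?_⟩, ?_⟩
      · rw [e]
        exact hd.killPair_apply f0 f0 f0 f1
      · rw [e]
        exact hd.contract₂₁ f0 f0 f0 f1)
  have s3 := Submodule.le_finrank_of_le_map φ₃ (M := S ⊓ LinearMap.ker φ₁ ⊓ LinearMap.ker φ₂)
    (N := pairSpan ω W (j + 1) (k - 1)) (by
      rw [pairSpan, Submodule.span_le]
      rintro w ⟨ps, ys, hc, hj, hk, rfl⟩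
      have hc1 : PairConfig ω (hyperbolicSpan R (p :: hs)) ps (p.1 :: ys) :=
        (hc.mono hle).cons hω hp1 (fun q hq =>
          ⟨(hv _ (hc.mem_pair q hq).1).1, (hv _ (hc.mem_pair q hq).2).1⟩)
          fun y hy => (hv _ (hc.mem y hy)).1
      have f1 := hc.free hω h
      have e : pairWedge F ps * wedge F (p.1 :: ys) =
          0 + ι F p.1 * (pairWedge F ps * wedge F ys) + ι F p.2 * 0 +
            ι F p.1 * (ι F p.2 * 0) := by
        simp [pairWedge_mul_ι_mul]
      refine ⟨_, ⟨⟨hc1.mem_pairSpan hj (by push_cast [List.length_cons]; omega), ?_⟩, ?_⟩, ?_⟩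
      · rw [e]
        exact hd.killPair_apply f0 f1 f0 f0
      · rw [e]
        exact hd.contract₂₁ f0 f1 f0 f0
      · rw [e]
        exact (hd.contract₁ f0 f1 f0 f0).trans (by simp))
  have s4 := Submodule.le_finrank_of_le_map φ₄
    (M := S ⊓ LinearMap.ker φ₁ ⊓ LinearMap.ker φ₂ ⊓ LinearMap.ker φ₃)
    (N := pairSpan ω W (j + 1) (k - 1)) (by
      rw [pairSpan, Submodule.span_le]
      rintro w ⟨ps, ys, hc, hj, hk, rfl⟩
      have hc1 : PairConfig ω (hyperbolicSpan R (p :: hs)) ps (p.2 :: ys) :=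
        (hc.mono hle).cons hω hp2 (fun q hq =>
          ⟨(hv _ (hc.mem_pair q hq).1).2, (hv _ (hc.mem_pair q hq).2).2⟩)
          fun y hy => (hv _ (hc.mem y hy)).2
      have f1 := hc.free hω h
      have e : pairWedge F ps * wedge F (p.2 :: ys) =
          0 + ι F p.1 * 0 + ι F p.2 * (pairWedge F ps * wedge F ys) +
            ι F p.1 * (ι F p.2 * 0) := by
        simp [pairWedge_mul_ι_mul]
      refine ⟨_, ⟨⟨⟨hc1.mem_pairSpan hj (by push_cast [List.length_cons]; omega), ?_⟩, ?_⟩, ?_⟩,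
        ?_⟩
      · rw [e]
        exact hd.killPair_apply f0 f0 f1 f0
      · rw [e]
        exact hd.contract₂₁ f0 f0 f1 f0
      · rw [e]
        exact (hd.contract₁ f0 f0 f1 f0).trans (by simp)
      · rw [e]
        exact (hd.contract₂ f0 f0 f1 f0).trans (by simp))
  omega

/-- No bound on `k` is needed: in the base case the span contains all of `⋀^k R`, and a nonnegative
binomial is discarded. -/
theorem le_finrank_pairSpan [FiniteDimensional F V] (hω : ω.IsAlt) {R : Submodule F V}
    {hs : List (V × V)} (h : IsHyperbolic ω R hs) (j : ℕ) (k : ℤ) :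
    binomial (2 * hs.length + finrank F R) k -
      binomial (2 * hs.length + finrank F R) (k - 2 * j) ≤
      (finrank F (pairSpan ω (hyperbolicSpan R hs) j k) : ℤ) := by
  induction hs generalizing j k with
  | nil =>
    cases j with
    | zero => simp
    | succ j =>
      have h1 : gradePiece R k ≤ pairSpan ω (hyperbolicSpan R []) (j + 1) k := by
        rw [gradePiece_eq_span, Submodule.span_le]
        rintro w ⟨l, hl, hk, rfl⟩
        have hc : PairConfig ω (hyperbolicSpan R []) [] l :=
          ⟨fun x hx y hy => h x (hl x hx) y (hl y hy), by simp, by simp, by simp, hl⟩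
        have := hc.mem_pairSpan (j := j + 1) (k := k) (by simp) (by simpa using hk)
        simpa using this
      have h1 := Submodule.finrank_mono h1
      have h2 := finrank_gradePiece R k
      have := binomial_nonneg (finrank F R) (k - 2 * ((j + 1 : ℕ) : ℤ))
      simp only [List.length_nil, mul_zero, zero_add]
      omega
  | cons p hs ih =>
    cases j with
    | zero => simp
    | succ j =>
      have h1 := finrank_pairSpan_cons hω h j k
      simp only [List.length_cons]
      have i1 := ih h.2.2 (j + 2) k
      have i2 := ih h.2.2 j (k - 2)
      have i3 := ih h.2.2 (j + 1) (k - 1)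
      have e : 2 * (hs.length + 1) + finrank F R = (2 * hs.length + finrank F R) + 2 := by ring
      rw [e, binomial_add_two, binomial_add_two]
      push_cast at *
      have g1 : k - 2 * ((j : ℤ) + 1) - 2 = k - 2 * (j + 2) := by ring
      have g2 : k - 2 * ((j : ℤ) + 1) - 1 = k - 1 - 2 * (j + 1) := by ring
      have g3 : k - 2 * ((j : ℤ) + 1) = k - 2 - 2 * j := by ring
      rw [g1, g2, g3]
      omega

end Lower

/-! ### Hyperbolic decomposition of an alternating form -/

section Decomposition

variable {ω : LinearMap.BilinForm F V}

/-- Every subspace is the orthogonal sum of hyperbolic planes and a totally isotropic subspace. -/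
lemma exists_isHyperbolic [FiniteDimensional F V] (hω : ω.IsAlt) (W : Submodule F V) :
    ∃ (R : Submodule F V) (hs : List (V × V)), IsHyperbolic ω R hs ∧ hyperbolicSpan R hs = W ∧
      finrank F W = 2 * hs.length + finrank F R := by
  induction hm : finrank F W using Nat.strong_induction_on generalizing W with
  | _ m ih =>
  by_cases h0 : ∀ x ∈ W, ∀ y ∈ W, ω x y = 0
  · exact ⟨W, [], h0, rfl, by simpa using hm.symm⟩
  · push Not at h0
    obtain ⟨e, he, f', hf', hef'⟩ := h0
    obtain ⟨f, hf, hef⟩ : ∃ f ∈ W, ω e f = 1 :=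
      ⟨(ω e f')⁻¹ • f', W.smul_mem _ hf', by simp [hef']⟩
    have hfe : ω f e = -1 := by rw [← LinearMap.IsAlt.neg hω, hef]
    let ψ : V →ₗ[F] F × F := (ω e).prod (ω f)
    let W' := W ⊓ LinearMap.ker ψ
    have hW' : ∀ u, u ∈ W' ↔ u ∈ W ∧ ω e u = 0 ∧ ω f u = 0 := by
      intro u
      simp [W', ψ]
    -- The functionals `ω e` and `ω f` map `W` onto `F × F`, already on `⟨e, f⟩`, so their common
    -- kernel in `W` has codimension 2.
    have hrank : finrank F W = finrank F W' + 2 := by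
      have h1 := LinearMap.finrank_range_add_finrank_ker (ψ.domRestrict W)
      have h2 : LinearMap.range (ψ.domRestrict W) = ⊤ := by
        rw [LinearMap.range_eq_top]
        rintro ⟨a, b⟩
        refine ⟨⟨a • f - b • e, sub_mem (W.smul_mem _ hf) (W.smul_mem _ he)⟩, ?_⟩
        simp [ψ, hef, hfe, hω e, hω f]
      have h3 : (LinearMap.ker (ψ.domRestrict W)).map W.subtype = W' := by
        rw [LinearMap.domRestrict, LinearMap.ker_comp, Submodule.map_comap_subtype]
      rw [h2, finrank_top, finrank_prod, finrank_self, ← Submodule.finrank_map_subtype_eq, h3] at h1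
      omega
    obtain ⟨R, hs, hh, hspan, hr⟩ := ih (finrank F W') (by omega) W' rfl
    refine ⟨R, (e, f) :: hs, ⟨hef, ?_, hh⟩, ?_, ?_⟩
    · rw [hspan]
      exact fun u hu => ((hW' u).mp hu).2
    · rw [hyperbolicSpan, hspan]
      apply le_antisymm
      · refine sup_le ?_ inf_le_left
        rw [Submodule.span_le]
        rintro x (rfl | rfl)
        · exact he
        · exact hf
      · intro x hx
        refine Submodule.mem_sup.mpr ⟨(ω x f) • e + (ω e x) • f,
          Submodule.mem_span_pair.mpr ⟨_, _, rfl⟩, x - ((ω x f) • e + (ω e x) • f), ?_, by abel⟩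
        rw [hW']
        refine ⟨sub_mem hx (add_mem (W.smul_mem _ he) (W.smul_mem _ hf)), ?_, ?_⟩
        · simp [hef, hω e]
        · rw [← LinearMap.IsAlt.neg hω f x]
          simp [hfe, hω f]
    · simp only [List.length_cons]
      omega

lemma IsHyperbolic.eq_ker (hω : ω.IsAlt) {R : Submodule F V} {hs : List (V × V)}
    (h : IsHyperbolic ω R hs) (htop : hyperbolicSpan R hs = ⊤) : R = LinearMap.ker ω := by
  have h1 : ∀ r ∈ R, r ∈ hyperbolicSpan R hs ∧ ∀ u ∈ hyperbolicSpan R hs, ω r u = 0 := by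
    clear htop
    induction hs with
    | nil => exact fun r hr => ⟨hr, h r hr⟩
    | cons p hs ih =>
      intro r hr
      obtain ⟨hm, ho⟩ := ih h.2.2 r hr
      refine ⟨hyperbolicSpan_le_cons R p hs hm, fun u hu => ?_⟩
      obtain ⟨α, β, u, hu', rfl⟩ := mem_hyperbolicSpan_cons hu
      have := h.2.1 r hm
      have e1 : ω r p.1 = 0 := by rw [← LinearMap.IsAlt.neg hω, this.1, neg_zero]
      have e2 : ω r p.2 = 0 := by rw [← LinearMap.IsAlt.neg hω, this.2, neg_zero]
      simp [e1, e2, ho u hu']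
  have h2 : ∀ x ∈ hyperbolicSpan R hs, (∀ u, ω x u = 0) → x ∈ R := by
    clear htop h1
    induction hs with
    | nil => exact fun x hx _ => hx
    | cons p hs ih =>
      intro x hx h0
      obtain ⟨α, β, u, hu, rfl⟩ := mem_hyperbolicSpan_cons hx
      have hu0 := h.2.1 u hu
      have e1 : ω u p.1 = 0 := by rw [← LinearMap.IsAlt.neg hω, hu0.1, neg_zero]
      have e2 : ω u p.2 = 0 := by rw [← LinearMap.IsAlt.neg hω, hu0.2, neg_zero]
      have e3 : ω p.2 p.1 = -1 := by rw [← LinearMap.IsAlt.neg hω, h.1]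
      have a1 := h0 p.1
      have a2 := h0 p.2
      simp [e1, e3, hω p.1] at a1
      simp [e2, h.1, hω p.2] at a2
      subst a1 a2
      simp only [zero_smul, zero_add] at h0 ⊢
      exact ih h.2.2 u hu h0
  ext x
  rw [LinearMap.mem_ker]
  constructor
  · intro hx
    ext u
    exact (h1 x hx).2 u (htop ▸ Submodule.mem_top)
  · intro hx
    exact h2 x (htop ▸ Submodule.mem_top) (fun u => by rw [hx]; rfl)

end Decomposition

/-! ### Spans of orthogonal products and their dimension for alternating forms -/

/-- The span of the products of `k` mutually orthogonal singular vectors, for an abstract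
orthogonality relation and an abstract set of singular vectors. -/
noncomputable def singularSpan (F : Type u) [Field F] {V : Type v} [AddCommGroup V] [Module F V]
    (Orth : V → V → Prop) (Sing : V → Prop) (k : ℕ) : Submodule F (ExteriorAlgebra F V) :=
  Submodule.span F {w | ∃ l : List V, l.length = k ∧ (∀ x ∈ l, Sing x) ∧
    (∀ x ∈ l, ∀ y ∈ l, Orth x y) ∧ w = wedge F l}

lemma singularSpan_one_of_isAlt {ω : LinearMap.BilinForm F V} (hω : ω.IsAlt) :
    singularSpan F (fun x y => ω x y = 0) (fun _ => True) 1 =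
      gradePiece (⊤ : Submodule F V) (1 : ℕ) := by
  rw [gradePiece_eq_span, singularSpan]
  congr 1
  ext w
  constructor
  · rintro ⟨l, hl, -, -, rfl⟩
    exact ⟨l, by simp, by exact_mod_cast hl, rfl⟩
  · rintro ⟨l, -, hl, rfl⟩
    have hl : l.length = 1 := by exact_mod_cast hl
    obtain ⟨x, rfl⟩ := List.length_eq_one_iff.mp hl
    exact ⟨[x], hl, by simp, by simp [hω x], rfl⟩

/-- The span lies between `pairSpan` and `contractionKernel` for `j = 1`, where the two bounds
coincide. The hypothesis says that `k` is at most the number of hyperbolic pairs. -/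
theorem finrank_singularSpan_of_isAlt [FiniteDimensional F V] {ω : LinearMap.BilinForm F V}
    (hω : ω.IsAlt) {k : ℕ} (hk : finrank F (LinearMap.ker ω) + 2 * k ≤ finrank F V) :
    (finrank F (singularSpan F (fun x y => ω x y = 0) (fun _ => True) k) : ℤ) =
      binomial (finrank F V) k - binomial (finrank F V) ((k : ℤ) - 2) := by
  obtain ⟨R, hs, hh, htop, hr⟩ := exists_isHyperbolic hω (⊤ : Submodule F V)
  rw [finrank_top] at hr
  have hR := hh.eq_ker hω htop
  have h1 := le_finrank_pairSpan hω hh 1 k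
  have h2 := finrank_contractionKernel_le hω hh 1 k (by rw [← hR] at hk; omega)
  have h3 : pairSpan ω (hyperbolicSpan R hs) 1 k ≤
      singularSpan F (fun x y => ω x y = 0) (fun _ => True) k := by
    rw [pairSpan, Submodule.span_le]
    rintro w ⟨ps, ys, hc, hj, hk, rfl⟩
    obtain rfl : ps = [] := by simpa using hj
    exact Submodule.subset_span ⟨ys, by simpa using hk, by simp, hc.iso, by simp⟩
  have h4 : singularSpan F (fun x y => ω x y = 0) (fun _ => True) k ≤
      contractionKernel ω R hs 1 k := by
    rw [singularSpan, Submodule.span_le]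
    rintro w ⟨l, rfl, -, hl, rfl⟩
    rw [SetLike.mem_coe, mem_contractionKernel]
    refine ⟨wedge_mem_gradePiece (by simp [htop]), ?_⟩
    clear h1 h2 h3 hk
    induction l with
    | nil =>
      intro s hs'
      obtain ⟨s, rfl⟩ : ∃ r, s = r + 1 := ⟨s - 1, by omega⟩
      clear hh htop hr
      induction hs generalizing s with
      | nil => rfl
      | cons p hs ih =>
        rw [dividedContraction_cons, ← dividedContraction_contractPair, contractPair,
          LinearMap.comp_apply, wedge_nil, contract_one, map_zero, map_zero, add_zero]
        exact ih s (by omega)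
    | cons y l ih =>
      simp only [List.forall_mem_cons] at hl
      have ih' := ih fun x hx y hy => (hl.2 x hx).2 y hy
      intro s hs'
      obtain ⟨s, rfl⟩ : ∃ r, s = r + 1 := ⟨s - 1, by omega⟩
      have hy : hyperbolicDual ω hs y = ω y := by
        ext x
        exact hyperbolicDual_apply hω hh (htop ▸ Submodule.mem_top) (htop ▸ Submodule.mem_top)
      rw [wedge_cons, dividedContraction_ι_mul, ih' (s + 1) (by omega), hy]
      -- What remains of the Leibniz rule is the contraction by `ω y` of a lower order: order zero
      -- vanishes because `y` is orthogonal to `l`, higher orders by induction.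
      cases s with
      | zero => simp [contract_wedge_eq_zero hl.1.2]
      | succ s => simp [ih' (s + 1) (by omega)]
  have h3 := Submodule.finrank_mono h3
  have h4 := Submodule.finrank_mono h4
  rw [← hr] at h1 h2
  push_cast at h1 h2
  omega

end ExteriorAlgebra

/-! ### Replacing arbitrary factors by orthogonal singular ones -/

/-- A reflexive sesquilinear form together with its set of singular vectors. -/
structure IsPolarData {F : Type u} [Field F] {V : Type v} [AddCommGroup V] [Module F V]
    {σ : F →+* F} (B : V →ₛₗ[σ] V →ₗ[F] F) (Sing : V → Prop) : Prop where
  involutive : Function.Involutive σ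
  refl : ∀ {x y}, B x y = 0 → B y x = 0
  comb : ∀ {x y}, Sing x → Sing y → B x y = 0 → ∀ a b : F, Sing (a • x + b • y)
  self : ∀ {x}, Sing x → B x x = 0
  adjust : ∀ {a x}, Sing a → B a x ≠ 0 → ∃ c : F, Sing (x + c • a)

namespace IsPolarData

variable {F : Type u} [Field F] {V : Type v} [AddCommGroup V] [Module F V]
  {σ : F →+* F} {B : V →ₛₗ[σ] V →ₗ[F] F} {Sing : V → Prop}

lemma smul (h : IsPolarData B Sing) {x : V} (hx : Sing x) (c : F) : Sing (c • x) := by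
  simpa using h.comb hx hx (h.self hx) c 0

lemma sub_smul (h : IsPolarData B Sing) {x y : V} (hx : Sing x) (hy : Sing y) (hxy : B x y = 0)
    (c : F) : Sing (x - c • y) := by
  simpa [sub_eq_add_neg] using h.comb hx hy hxy 1 (-c)

/-- A totally isotropic subspace which is too small does not contain, modulo the radical, all
vectors of a given totally singular subspace that are orthogonal to it. -/
lemma exists_not_mem [FiniteDimensional F V] {E M : Submodule F V}
    (hE : ∀ x ∈ E, ∀ y ∈ E, B x y = 0) (hEB : E ⊓ LinearMap.ker B = ⊥)
    (hM : finrank F M < finrank F E) :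
    ∃ s ∈ E, (∀ m ∈ M, B m s = 0) ∧ s ∉ M ⊔ LinearMap.ker B := by
  by_contra! hcon
  -- Dimension count. `M₀` is the part of `M` orthogonal to `E` and `M₁` a complement of it in `M`.
  -- So `E₀`, the vectors of `E` orthogonal to `M₁`, is orthogonal to `M` and has dimension at least
  -- `dim E - dim M₁ > dim M₀`.
  let M₀ : Submodule F V :=
    { carrier := {m | m ∈ M ∧ ∀ e ∈ E, B m e = 0}
      zero_mem' := ⟨M.zero_mem, by simp⟩
      add_mem' := fun {a b} ha hb => ⟨M.add_mem ha.1 hb.1, fun e he => by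
        simp [ha.2 e he, hb.2 e he]⟩
      smul_mem' := fun c a ha => ⟨M.smul_mem c ha.1, fun e he => by simp [ha.2 e he]⟩ }
  have hM₀ : M₀ ≤ M := fun m hm => hm.1
  obtain ⟨C, hC⟩ := M₀.exists_isCompl
  have hsup : M₀ ⊔ C ⊓ M = M := by
    rw [← sup_inf_assoc_of_le C hM₀, hC.sup_eq_top, top_inf_eq]
  have hinf : M₀ ⊓ (C ⊓ M) = ⊥ := by
    rw [← inf_assoc, hC.inf_eq_bot, bot_inf_eq]
  have hdim := Submodule.finrank_sup_add_finrank_inf_eq M₀ (C ⊓ M)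
  rw [hsup, hinf, finrank_bot] at hdim
  set M₁ := C ⊓ M
  let b := Module.finBasis F M₁
  let ψ : E →ₗ[F] (Fin (finrank F M₁) → F) :=
    LinearMap.pi fun i => (B (b i)).domRestrict E
  have hψ := LinearMap.finrank_range_add_finrank_ker ψ
  have hψ' : finrank F (LinearMap.range ψ) ≤ finrank F M₁ :=
    (Submodule.finrank_le _).trans (by simp)
  set E₀ := (LinearMap.ker ψ).map E.subtype with hE₀
  have hE₀r : finrank F E₀ = finrank F (LinearMap.ker ψ) := Submodule.finrank_map_subtype_eq _ _
  have hmem : E₀ ≤ M₀ ⊔ LinearMap.ker B := by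
    rintro _ ⟨e, he, rfl⟩
    have he1 : ∀ m ∈ M₁, B m e = 0 := by
      intro m hm
      have hm' : m = ∑ i, (b.repr ⟨m, hm⟩ i) • (b i : V) := by
        have := congrArg M₁.subtype (b.sum_repr ⟨m, hm⟩)
        simpa only [map_sum, map_smul, Submodule.subtype_apply] using this.symm
      rw [hm', map_sum, LinearMap.sum_apply]
      refine Finset.sum_eq_zero fun i _ => ?_
      have := congrFun (show ψ e = 0 from he) i
      simp only [ψ, LinearMap.pi_apply, LinearMap.domRestrict_apply, Pi.zero_apply] at this
      simp [this]
    have he2 : ∀ m ∈ M, B m e = 0 := by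
      intro m hm
      rw [← hsup] at hm
      obtain ⟨m0, hm0, m1, hm1, rfl⟩ := Submodule.mem_sup.mp hm
      simp [hm0.2 e e.2, he1 m1 hm1]
    obtain ⟨m, hm, r, hr, hmr⟩ := Submodule.mem_sup.mp (hcon e e.2 he2)
    refine Submodule.mem_sup.mpr ⟨m, ⟨hm, fun e' he' => ?_⟩, r, hr, hmr⟩
    -- Modulo the radical, `m` equals `e`, which is orthogonal to `E`. Hence `E₀` lies in `M₀ +
    -- Rad`, which is too small, as `E₀` meets the radical trivially.
    have h1 : B e e' = 0 := hE e e.2 e' he'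
    rw [← hmr, map_add, LinearMap.add_apply, LinearMap.mem_ker.mp hr] at h1
    simpa using h1
  have hbot : E₀ ⊓ LinearMap.ker B = ⊥ := by
    rw [eq_bot_iff, ← hEB]
    refine inf_le_inf_right _ ?_
    rintro _ ⟨e, -, rfl⟩
    exact e.2
  have d1 := Submodule.finrank_sup_add_finrank_inf_eq E₀ (LinearMap.ker B)
  rw [hbot, finrank_bot] at d1
  have d2 := Submodule.finrank_mono (sup_le hmem le_sup_right : E₀ ⊔ LinearMap.ker B ≤ _)
  have d3 := Submodule.finrank_add_le_finrank_add_finrank M₀ (LinearMap.ker B)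
  omega

/-- A vector outside of `M + Rad` is separated from `M` by a vector orthogonal to `M`. -/
lemma exists_orthogonal_ne_zero [FiniteDimensional F V] (h : IsPolarData B Sing)
    {M : Submodule F V} {a : V} (ha : a ∉ M ⊔ LinearMap.ker B) :
    ∃ b, (∀ m ∈ M, B m b = 0) ∧ B a b ≠ 0 := by
  by_contra! hcon
  apply ha
  let b := Module.finBasis F M
  have hmem : ∀ x : V, (∀ i, B (b i) x = 0) → ∀ m ∈ M, B m x = 0 := by
    intro x hx m hm
    have hm' : m = ∑ i, (b.repr ⟨m, hm⟩ i) • (b i : V) := by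
      have := congrArg M.subtype (b.sum_repr ⟨m, hm⟩)
      simpa only [map_sum, map_smul, Submodule.subtype_apply] using this.symm
    rw [hm', map_sum, LinearMap.sum_apply]
    exact Finset.sum_eq_zero fun i _ => by simp [hx i]
  have hspan : B a ∈ Submodule.span F (Set.range fun i => B (b i)) := by
    apply mem_span_of_iInf_ker_le_ker
    intro x hx
    simp only [Submodule.mem_iInf, LinearMap.mem_ker] at hx
    exact hcon x (hmem x hx)
  obtain ⟨c, hc⟩ := (Submodule.mem_span_range_iff_exists_fun F).mp hspan
  -- The coefficients carry `σ` because `B` is semilinear in its first argument and `σ` is an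
  -- involution.
  refine Submodule.mem_sup.mpr ⟨∑ i, σ (c i) • (b i : V),
    Submodule.sum_mem _ fun i _ => M.smul_mem _ (b i).2,
    a - ∑ i, σ (c i) • (b i : V), ?_, by abel⟩
  rw [LinearMap.mem_ker, map_sub, map_sum, sub_eq_zero, ← hc]
  refine Finset.sum_congr rfl fun i _ => ?_
  rw [map_smulₛₗ, h.involutive]

section Frame

variable [FiniteDimensional F V] {E : Submodule F V} (h : IsPolarData B Sing)
  (hES : ∀ x ∈ E, Sing x) (hE : ∀ x ∈ E, ∀ y ∈ E, B x y = 0) (hEB : E ⊓ LinearMap.ker B = ⊥)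

include h hES hE hEB

/-- The orthogonal of a small totally isotropic subspace is spanned by singular vectors. -/
lemma mem_span_singular {M : Submodule F V} (hM : finrank F M < finrank F E) {x : V}
    (hx : ∀ m ∈ M, B m x = 0) : x ∈ Submodule.span F {s | Sing s ∧ ∀ m ∈ M, B m s = 0} := by
  obtain ⟨a, haE, haM, ha⟩ := exists_not_mem hE hEB hM
  obtain ⟨b, hb, hab⟩ := h.exists_orthogonal_ne_zero ha
  -- A vector not orthogonal to the singular vector `a` becomes singular after adding a multiple of
  -- `a`. A vector orthogonal to `a` is first moved by `b`.
  have key : ∀ y, (∀ m ∈ M, B m y = 0) → B a y ≠ 0 →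
      y ∈ Submodule.span F {s | Sing s ∧ ∀ m ∈ M, B m s = 0} := by
    intro y hy hay
    obtain ⟨c, hc⟩ := h.adjust (hES a haE) hay
    have : y = (y + c • a) - c • a := by abel
    rw [this]
    refine sub_mem (Submodule.subset_span ⟨hc, fun m hm => ?_⟩)
      (Submodule.smul_mem _ _ (Submodule.subset_span ⟨hES a haE, haM⟩))
    simp [hy m hm, haM m hm]
  by_cases hax : B a x = 0
  · have : x = (x + b) - b := by abel
    rw [this]
    refine sub_mem (key _ (fun m hm => ?_) ?_) (key b hb hab)
    · simp [hx m hm, hb m hm]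
    · simpa [hax] using hab
  · exact key x hx hax

end Frame

lemma forall_span_left {l : List V} {y : V} (hl : ∀ x ∈ l, B x y = 0) :
    ∀ x ∈ Submodule.span F {x | x ∈ l}, B x y = 0 := by
  intro x hx
  induction hx using Submodule.span_induction with
  | mem x hx => exact hl x hx
  | zero => simp
  | add a b _ _ ha hb => simp [ha, hb]
  | smul c a _ ha => simp [ha]

lemma finrank_span_list_le [FiniteDimensional F V] (l : List V) :
    finrank F (Submodule.span F {x | x ∈ l}) ≤ l.length := by
  classical
  have : {x | x ∈ l} = (l.toFinset : Set V) := by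
    ext
    simp
  rw [this]
  exact (finrank_span_finset_le_card _).trans (List.toFinset_card_le l)

open ExteriorAlgebra

lemma wedge_mem_singularSpan {l : List V} (hS : ∀ x ∈ l, Sing x)
    (hl : ∀ x ∈ l, ∀ y ∈ l, B x y = 0) {k : ℕ} (hk : l.length = k) :
    wedge F l ∈ singularSpan F (fun x y => B x y = 0) Sing k :=
  Submodule.subset_span ⟨l, hk, hS, hl, rfl⟩

section Frame

variable [FiniteDimensional F V] {E : Submodule F V} (h : IsPolarData B Sing)
  (hES : ∀ x ∈ E, Sing x) (hE : ∀ x ∈ E, ∀ y ∈ E, B x y = 0) (hEB : E ⊓ LinearMap.ker B = ⊥)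

include h hES hE hEB

/-- The factors in `l₂` are already singular. The head of `l₁` is expanded into singular vectors
orthogonal to all other factors, and each of them moves to `l₂` at the cost of a sign. -/
lemma wedge_append_mem_singularSpan (l₁ l₂ : List V) (hS : ∀ x ∈ l₂, Sing x)
    (hl : ∀ x ∈ l₁ ++ l₂, ∀ y ∈ l₁ ++ l₂, B x y = 0)
    (hlen : l₁.length + l₂.length ≤ finrank F E) :
    wedge F (l₁ ++ l₂) ∈
      singularSpan F (fun x y => B x y = 0) Sing (l₁.length + l₂.length) := by
  induction l₁ generalizing l₂ with
  | nil => exact wedge_mem_singularSpan hS hl (by simp)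
  | cons x l₁ ih =>
    simp only [List.cons_append, List.forall_mem_cons] at hl
    have hr := finrank_span_list_le (F := F) (l₁ ++ l₂)
    simp only [List.length_append, List.length_cons] at hr hlen
    have hx := h.mem_span_singular hES hE hEB (M := Submodule.span F {x | x ∈ l₁ ++ l₂})
      (by omega) (forall_span_left fun y hy => (hl.2 y hy).1)
    rw [List.cons_append, wedge_cons, List.length_cons]
    have hl₀ : ∀ x ∈ l₁ ++ l₂, ∀ y ∈ l₁ ++ l₂, B x y = 0 := fun x hx => (hl.2 x hx).2
    clear hl
    induction hx using Submodule.span_induction with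
    | mem s hs =>
      have hs2 : ∀ y ∈ l₁ ++ l₂, B y s = 0 := fun y hy => hs.2 y (Submodule.subset_span hy)
      have e : ι F s * wedge F (l₁ ++ l₂) =
          (-1 : F) ^ l₁.length • wedge F (l₁ ++ s :: l₂) := by
        rw [wedge_middle, smul_smul, ← mul_pow]
        simp
      rw [e]
      apply Submodule.smul_mem
      have := ih (s :: l₂) (by simpa using ⟨hs.1, hS⟩) ?_ (by simp only [List.length_cons]; omega)
      · convert this using 2
        simp only [List.length_cons]
        omega
      · have hm : ∀ x ∈ l₁ ++ s :: l₂, x = s ∨ x ∈ l₁ ++ l₂ := by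
          intro x hx
          simp only [List.mem_append, List.mem_cons] at hx ⊢
          tauto
        intro x hx y hy
        rcases hm x hx with rfl | hx' <;> rcases hm y hy with rfl | hy'
        · exact h.self hs.1
        · exact h.refl (hs2 y hy')
        · exact hs2 x hx'
        · exact hl₀ x hx' y hy'
    | zero => simp
    | add a b _ _ ha hb => rw [map_add, add_mul]; exact add_mem ha hb
    | smul c a _ ha => rw [map_smul, smul_mul_assoc]; exact Submodule.smul_mem _ c ha

/-- Replacing all vectors of isotropic products by singular ones does not change the span. -/
theorem singularSpan_eq_of_isotropic {k : ℕ} (hk : k ≤ finrank F E) :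
    singularSpan F (fun x y => B x y = 0) Sing k =
      singularSpan F (fun x y => B x y = 0) (fun _ => True) k := by
  apply le_antisymm
  · rw [singularSpan, Submodule.span_le]
    rintro w ⟨l, hlen, -, hl, rfl⟩
    exact Submodule.subset_span ⟨l, hlen, by simp, hl, rfl⟩
  · rw [singularSpan, Submodule.span_le]
    rintro w ⟨l, rfl, -, hl, rfl⟩
    simpa using h.wedge_append_mem_singularSpan hES hE hEB l [] (by simp) (by simpa using hl)
      (by simpa using hk)

end Frame

lemma wedge_cons_map_sub (p : V) (φ : V → F) (l : List V) :
    ι F p * wedge F (l.map fun y => y - φ y • p) = ι F p * wedge F l := by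
  induction l with
  | nil => rfl
  | cons y l ih =>
    rw [List.map_cons, wedge_cons, wedge_cons, map_sub, map_smul, sub_mul, mul_sub,
      smul_mul_assoc, mul_smul_comm, ι_mul_ι_mul_self, smul_zero, sub_zero,
      ι_mul_ι_mul_swap p y, ih, ι_mul_ι_mul_swap p y]

/-- The exterior product of a hyperbolic pair can be written in terms of pairs of orthogonal
singular vectors, with the help of a hyperbolic pair orthogonal to the given one. -/
def HyperbolicExchange (B : V →ₛₗ[σ] V →ₗ[F] F) (Sing : V → Prop) : Prop :=
  ∀ p x a b : V, Sing p → Sing x → Sing a → Sing b → B p x = 1 → B a b = 1 →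
    B p a = 0 → B p b = 0 → B x a = 0 → B x b = 0 →
    ι F p * ι F x ∈ Submodule.span F {w | ∃ s t : V, s ∈ Submodule.span F {p, x, a, b} ∧
      t ∈ Submodule.span F {p, x, a, b} ∧ Sing s ∧ Sing t ∧ B s t = 0 ∧ w = ι F s * ι F t}

section Frame

variable [FiniteDimensional F V] {E : Submodule F V} (h : IsPolarData B Sing)
  (hES : ∀ x ∈ E, Sing x) (hE : ∀ x ∈ E, ∀ y ∈ E, B x y = 0) (hEB : E ⊓ LinearMap.ker B = ⊥)

include h hES hE hEB

/-- The bound on the length leaves room for a second hyperbolic pair `a, b` orthogonal to `p`, `x`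
and `l`, to which `HyperbolicExchange` applies. -/
lemma ι_mul_ι_mul_wedge_mem (H : HyperbolicExchange B Sing) {p x : V} {l : List V} (hp : Sing p)
    (hpx : B p x ≠ 0) (hS : ∀ y ∈ l, Sing y) (hl : ∀ y ∈ l, ∀ z ∈ l, B y z = 0)
    (hpl : ∀ y ∈ l, B y p = 0) (hxl : ∀ y ∈ l, B y x = 0) (hlen : l.length + 2 ≤ finrank F E) :
    ι F p * (ι F x * wedge F l) ∈
      singularSpan F (fun x y => B x y = 0) Sing (l.length + 2) := by
  have hpp := h.self hp
  -- Adding a multiple of `p` to `x` does not change `p ∧ x`, and rescaling `x` only rescales it.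
  wlog hx : Sing x ∧ B p x = 1 generalizing x with hwlog
  · obtain ⟨c, hc⟩ := h.adjust hp hpx
    have h1 : B p (x + c • p) = B p x := by simp [hpp]
    have := hwlog (x := (B p x)⁻¹ • (x + c • p)) (by simp [hpp, hpx])
      (fun y hy => by simp [hpl y hy, hxl y hy]) ⟨h.smul hc _, by simp [hpp, hpx]⟩
    have e : ι F p * (ι F x * wedge F l) =
        B p x • (ι F p * (ι F ((B p x)⁻¹ • (x + c • p)) * wedge F l)) := by
      simp only [map_smul, map_add, add_mul, smul_mul_assoc, mul_smul_comm, mul_add, smul_add,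
        ι_mul_ι_mul_self, smul_zero, add_zero, smul_smul, mul_inv_cancel₀ hpx, one_smul]
    rw [e]
    exact Submodule.smul_mem _ _ this
  obtain ⟨hxS, hpx1⟩ := hx
  have hxp : B x p ≠ 0 := fun h0 => hpx (h.refl h0)
  set M := Submodule.span F {y | y ∈ p :: l} with hMdef
  have hMr : finrank F M ≤ (p :: l).length := finrank_span_list_le _
  have hpM : p ∈ M := Submodule.subset_span (by simp)
  have hlM : ∀ y ∈ l, y ∈ M := fun y hy => Submodule.subset_span (by simp [hy])
  obtain ⟨s, hsE, hsM, hs⟩ := exists_not_mem hE hEB (M := M) (by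
    simp only [List.length_cons] at hMr; omega)
  -- Subtracting `c • p` makes `a` orthogonal to `x` without spoiling its orthogonality to `p` and
  -- `l`.
  let c := B x s / B x p
  let a := s - c • p
  have haS : Sing a := h.sub_smul (hES s hsE) hp (h.refl (hsM p hpM)) c
  have hpa : B p a = 0 := by simp [a, hsM p hpM, hpp]
  have hla : ∀ y ∈ l, B y a = 0 := fun y hy => by simp [a, hsM y (hlM y hy), hpl y hy]
  have hxa : B x a = 0 := by simp [a, c, hxp]
  have haM : a ∉ Submodule.span F {y | y ∈ x :: p :: l} ⊔ LinearMap.ker B := by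
    intro hmem
    obtain ⟨m, hm, r, hr, hmr⟩ := Submodule.mem_sup.mp hmem
    have hins : {y | y ∈ x :: p :: l} = insert x {y | y ∈ p :: l} := by
      ext
      simp
    rw [hins, Submodule.mem_span_insert] at hm
    obtain ⟨α, m, hm, rfl⟩ := hm
    have hpm : B p m = 0 := by
      apply h.refl
      refine forall_span_left (l := p :: l) ?_ m hm
      simpa using ⟨hpp, hpl⟩
    have hpr : B p r = 0 := h.refl (by rw [LinearMap.mem_ker.mp hr]; rfl)
    -- Pairing with `p` isolates the coefficient of `x`, since `p` is orthogonal to everything else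
    -- in the relation, `a` included.
    have hα : α = 0 := by
      have := hpa
      rw [← hmr] at this
      simpa [hpm, hpr, hpx1] using this
    apply hs
    have : s = (m + c • p) + r := by
      have : s = a + c • p := by simp [a]
      rw [this, ← hmr, hα]
      simp only [zero_smul, zero_add]
      abel
    rw [this]
    exact Submodule.add_mem_sup (M.add_mem hm (M.smul_mem _ hpM)) hr
  obtain ⟨b₀, hb₀, hab₀⟩ := h.exists_orthogonal_ne_zero haM
  have hb₀' : ∀ y ∈ x :: p :: l, B y b₀ = 0 := fun y hy => hb₀ y (Submodule.subset_span hy)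
  simp only [List.forall_mem_cons] at hb₀'
  obtain ⟨r, hr⟩ := h.adjust haS hab₀
  have haa := h.self haS
  have hmem := H p x a ((B a b₀)⁻¹ • (b₀ + r • a)) hp hxS haS (h.smul hr _) hpx1
    (by simp [haa, hab₀]) hpa (by simp [hb₀', hpa]) hxa (by simp [hb₀', hxa])
  set b := (B a b₀)⁻¹ • (b₀ + r • a)
  have hlb : ∀ y ∈ l, B y b = 0 := fun y hy => by simp [b, hla y hy, hb₀'.2.2 y hy]
  rw [← mul_assoc]
  have hspan : ∀ y ∈ l, ∀ z ∈ Submodule.span F {p, x, a, b}, B y z = 0 := by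
    intro y hy z hz
    have : Submodule.span F {p, x, a, b} ≤ LinearMap.ker (B y) := by
      rw [Submodule.span_le]
      rintro z (rfl | rfl | rfl | rfl)
      · exact hpl y hy
      · exact hxl y hy
      · exact hla y hy
      · exact hlb y hy
    exact this hz
  generalize ι F p * ι F x = z at hmem ⊢
  induction hmem using Submodule.span_induction with
  | mem w hw =>
    obtain ⟨s, t, hsm, htm, hs, ht, hst, rfl⟩ := hw
    have : ι F s * ι F t * wedge F l = wedge F (s :: t :: l) := by simp [mul_assoc]
    rw [this]
    apply wedge_mem_singularSpan
    · simpa using ⟨hs, ht, hS⟩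
    · simp only [List.forall_mem_cons]
      exact ⟨⟨h.self hs, hst, fun y hy => h.refl (hspan y hy s hsm)⟩,
        ⟨h.refl hst, h.self ht, fun y hy => h.refl (hspan y hy t htm)⟩,
        fun y hy => ⟨hspan y hy s hsm, hspan y hy t htm, hl y hy⟩⟩
    · rfl
  | zero => simp
  | add a b _ _ ha hb => rw [add_mul]; exact add_mem ha hb
  | smul c a _ ha => rw [smul_mul_assoc]; exact Submodule.smul_mem _ c ha

/-- Either `x` is orthogonal to all factors and splits into singular vectors that are too, or some
factor `p` is not orthogonal to `x` and the other factors can be corrected by multiples of `p`,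
which `p ∧ ·` absorbs. -/
lemma ι_mul_wedge_mem (H : HyperbolicExchange B Sing) (x : V) {l : List V}
    (hS : ∀ y ∈ l, Sing y) (hl : ∀ y ∈ l, ∀ z ∈ l, B y z = 0)
    (hlen : l.length + 1 ≤ finrank F E) :
    ι F x * wedge F l ∈ singularSpan F (fun x y => B x y = 0) Sing (l.length + 1) := by
  by_cases hx : ∀ y ∈ l, B y x = 0
  · have hr := finrank_span_list_le (F := F) l
    replace hx := h.mem_span_singular hES hE hEB (M := Submodule.span F {x | x ∈ l}) (by omega)
      (forall_span_left hx)
    induction hx using Submodule.span_induction with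
    | mem s hs =>
      have hs2 : ∀ y ∈ l, B y s = 0 := fun y hy => hs.2 y (Submodule.subset_span hy)
      rw [← wedge_cons]
      apply wedge_mem_singularSpan
      · simpa using ⟨hs.1, hS⟩
      · simp only [List.forall_mem_cons]
        exact ⟨⟨h.self hs.1, fun y hy => h.refl (hs2 y hy)⟩, fun y hy => ⟨hs2 y hy, hl y hy⟩⟩
      · rfl
    | zero => simp
    | add a b _ _ ha hb => rw [map_add, add_mul]; exact add_mem ha hb
    | smul c a _ ha => rw [map_smul, smul_mul_assoc]; exact Submodule.smul_mem _ c ha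
  · push Not at hx
    obtain ⟨p, hp, hpx⟩ := hx
    obtain ⟨l₁, l₂, rfl⟩ := List.append_of_mem hp
    have hsub : ∀ y ∈ l₁ ++ l₂, y ∈ l₁ ++ p :: l₂ := by
      intro y hy
      simp only [List.mem_append, List.mem_cons] at hy ⊢
      tauto
    -- With this coefficient `B (y - φ y • p) x = 0`; the outer `σ` undoes the semilinearity in the
    -- first argument.
    let φ : V → F := fun y => σ (B y x / B p x)
    let l' := (l₁ ++ l₂).map fun y => y - φ y • p
    have hpS := hS p hp
    have hpp := h.self hpS
    have hyp : ∀ y ∈ l₁ ++ l₂, B y p = 0 := fun y hy => hl y (hsub y hy) p hp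
    have hpy : ∀ y ∈ l₁ ++ l₂, B p y = 0 := fun y hy => hl p hp y (hsub y hy)
    have hl' : ∀ z ∈ l', ∃ y ∈ l₁ ++ l₂, y - φ y • p = z := fun z hz => List.mem_map.mp hz
    have hlen' : l'.length + 2 = (l₁ ++ p :: l₂).length + 1 := by
      simp [l']
      omega
    have key := h.ι_mul_ι_mul_wedge_mem hES hE hEB H hpS hpx (l := l') ?_ ?_ ?_ ?_ (by omega)
    · rw [wedge_middle, wedge_cons, mul_smul_comm, ← wedge_cons_map_sub p φ,
        ι_mul_ι_mul_swap x p]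
      rw [hlen'] at key
      exact Submodule.smul_mem _ _ (Submodule.neg_mem _ key)
    · intro z hz
      obtain ⟨y, hy, rfl⟩ := hl' z hz
      exact h.sub_smul (hS y (hsub y hy)) hpS (hyp y hy) _
    · intro z hz z' hz'
      obtain ⟨y, hy, rfl⟩ := hl' z hz
      obtain ⟨y', hy', rfl⟩ := hl' z' hz'
      simp [hl y (hsub y hy) y' (hsub y' hy'), hyp y hy, hpy y' hy', hpp]
    · intro z hz
      obtain ⟨y, hy, rfl⟩ := hl' z hz
      simp [hyp y hy, hpp]
    · intro z hz
      obtain ⟨y, hy, rfl⟩ := hl' z hz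
      simp only [map_sub, map_smulₛₗ, LinearMap.sub_apply, LinearMap.smul_apply, φ,
        smul_eq_mul, h.involutive _]
      rw [div_mul_cancel₀ _ hpx, sub_self]

/-- The products of `k` mutually orthogonal singular vectors span `⋀^k V`. -/
theorem singularSpan_eq_gradePiece_top (H : HyperbolicExchange B Sing) {k : ℕ}
    (hk : k ≤ finrank F E) :
    singularSpan F (fun x y => B x y = 0) Sing k = gradePiece (⊤ : Submodule F V) k := by
  apply le_antisymm
  · rw [singularSpan, Submodule.span_le]
    rintro w ⟨l, rfl, -, -, rfl⟩
    exact wedge_mem_gradePiece (by simp)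
  · rw [gradePiece_eq_span, Submodule.span_le]
    rintro w ⟨l, -, hlen, rfl⟩
    obtain rfl : l.length = k := by exact_mod_cast hlen
    clear hlen
    induction l with
    | nil => exact wedge_mem_singularSpan (by simp) (by simp) rfl
    | cons x l ih =>
      simp only [List.length_cons] at hk
      have hw := ih (by omega)
      rw [SetLike.mem_coe, singularSpan] at hw
      rw [SetLike.mem_coe, wedge_cons, List.length_cons]
      generalize wedge F l = z at hw ⊢
      induction hw using Submodule.span_induction with
      | mem w hw =>
        obtain ⟨l', hlen, hS, hl, rfl⟩ := hw
        rw [← hlen]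
        exact h.ι_mul_wedge_mem hES hE hEB H x hS hl (by omega)
      | zero => simp
      | add a b _ _ ha hb => rw [mul_add]; exact add_mem ha hb
      | smul c a _ ha => rw [mul_smul_comm]; exact Submodule.smul_mem _ c ha

end Frame

end IsPolarData

namespace PolarForm

variable {F : Type u} [Field F] {V : Type v} [AddCommGroup V] [Module F V]

open ExteriorAlgebra

/-! ### From the Grassmann embedding to the exterior algebra -/

section Bridge

lemma gradePiece_top (k : ℕ) : gradePiece (⊤ : Submodule F V) k = ⋀[F]^k V := by
  rw [gradePiece_natCast, Submodule.map_top]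

lemma coe_ιMulti (k : ℕ) (v : Fin k → V) :
    (exteriorPower.ιMulti F k v : ExteriorAlgebra F V) = wedge F (List.ofFn v) := by
  rw [exteriorPower.ιMulti_apply_coe, ExteriorAlgebra.ιMulti_apply, wedge, List.map_ofFn]
  rfl

variable [FiniteDimensional F V]

/-- The span of the image of the Grassmann embedding is the span of the products of mutually
orthogonal singular vectors. -/
lemma map_submodule_embeddingSpan (η : PolarForm F V) (k : ℕ) {Orth : V → V → Prop}
    {Sing : V → Prop}
    (h₁ : ∀ X, η.TotallySingular X → (∀ x ∈ X, Sing x) ∧ ∀ x ∈ X, ∀ y ∈ X, Orth x y)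
    (h₂ : ∀ l : List V, (∀ x ∈ l, Sing x) → (∀ x ∈ l, ∀ y ∈ l, Orth x y) →
      η.TotallySingular (Submodule.span F {x | x ∈ l})) :
    (Projectivization.Subspace.submodule (η.embeddingSpan k)).map (⋀[F]^k V).subtype =
      singularSpan F Orth Sing k := by
  apply le_antisymm
  · rw [Submodule.map_le_iff_le_comap, ← OrderIso.le_symm_apply, embeddingSpan,
      Projectivization.Subspace.span_le_subspace_iff]
    rintro _ ⟨X, rfl⟩
    change η.PolarPoint k at X
    obtain ⟨⟨X, hX⟩, hTS⟩ := X
    let b : Basis (Fin k) F X := (finBasis F X).reindex (finCongr hX)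
    obtain ⟨hne, hp⟩ := pluckerMap_eq_mk ⟨X, hX⟩ b
    change pluckerMap k ⟨X, hX⟩ ∈ _
    rw [hp, SetLike.mem_coe, Submodule.mk_mem_projectivization_iff, Submodule.mem_comap, Submodule.subtype_apply,
      coe_ιMulti]
    obtain ⟨hS, hO⟩ := h₁ X hTS
    refine Submodule.subset_span ⟨_, List.length_ofFn, ?_, ?_, rfl⟩
    · intro x hx
      obtain ⟨i, rfl⟩ := (List.mem_ofFn' _ _).mp hx
      exact hS _ (b i).2
    · intro x hx y hy
      obtain ⟨i, rfl⟩ := (List.mem_ofFn' _ _).mp hx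
      obtain ⟨j, rfl⟩ := (List.mem_ofFn' _ _).mp hy
      exact hO _ (b i).2 _ (b j).2
  · rw [singularSpan, Submodule.span_le]
    rintro w ⟨l, rfl, hS, hO, rfl⟩
    refine ⟨exteriorPower.ιMulti F l.length l.get, ?_, by
      rw [Submodule.subtype_apply, coe_ιMulti, List.ofFn_get]⟩
    by_cases hli : LinearIndependent F l.get
    · have hrange : Set.range l.get = {x | x ∈ l} := by
        ext x
        simp [List.mem_iff_get]
      have hX : finrank F (Submodule.span F (Set.range l.get)) = l.length := by
        rw [finrank_span_eq_card hli, Fintype.card_fin]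
      let X : GrassmannPoint F V l.length := ⟨_, hX⟩
      have hTS : η.TotallySingular X.1 := by
        change η.TotallySingular (Submodule.span F (Set.range l.get))
        rw [hrange]
        exact h₂ l hS hO
      obtain ⟨hne, hp⟩ := pluckerMap_eq_mk X (Basis.span hli)
      have hv : (fun i => ((Basis.span hli i : X.1) : V)) = l.get := by
        ext i
        rw [Basis.span_apply hli i]
      simp only [hv] at hne hp
      rw [SetLike.mem_coe, Projectivization.Subspace.mem_submodule_iff _ hne, ← hp]
      let Y : η.PolarPoint l.length := ⟨X, hTS⟩
      exact Projectivization.Subspace.subset_span _ ⟨Y, rfl⟩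
    -- A dependent list gives no point of the Grassmannian, but its product is zero.
    · rw [AlternatingMap.map_linearDependent _ _ hli]
      exact zero_mem _

lemma embeddingDim_eq (η : PolarForm F V) (k : ℕ) {S : Submodule F (ExteriorAlgebra F V)}
    (h : (Projectivization.Subspace.submodule (η.embeddingSpan k)).map (⋀[F]^k V).subtype = S) :
    η.embeddingDim k = finrank F S := by
  rw [← h, Submodule.finrank_map_subtype_eq, embeddingDim]

lemma embeddingSpan_eq_top (η : PolarForm F V) (k : ℕ)
    (h : (Projectivization.Subspace.submodule (η.embeddingSpan k)).map (⋀[F]^k V).subtype =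
      gradePiece (⊤ : Submodule F V) k) :
    η.embeddingSpan k = ⊤ := by
  apply Projectivization.Subspace.submodule.injective
  rw [map_top, eq_top_iff]
  intro x _
  have hx : (x : ExteriorAlgebra F V) ∈ gradePiece (⊤ : Submodule F V) k := by
    rw [gradePiece_top]
    exact x.2
  rw [← h] at hx
  obtain ⟨y, hy, hyx⟩ := hx
  rwa [← Subtype.ext hyx]

lemma exists_finrank_eq_wittIndex (η : PolarForm F V) :
    ∃ X : Submodule F V, η.TotallySingular X ∧ finrank F X = η.wittIndex := by
  have hne : {m | ∃ X : Submodule F V, η.TotallySingular X ∧ finrank F X = m}.Nonempty := by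
    refine ⟨0, ⊥, ?_, finrank_bot F V⟩
    cases η <;> simp [TotallySingular]
  have hb : BddAbove {m | ∃ X : Submodule F V, η.TotallySingular X ∧ finrank F X = m} := by
    refine ⟨finrank F V, ?_⟩
    rintro m ⟨X, -, rfl⟩
    exact X.finrank_le
  exact Nat.sSup_mem hne hb

/-- A linear section of the quotient map lifts a largest totally singular subspace of `V / Rad`, and
the image of a section meets the radical trivially. -/
lemma exists_totallySingular (η : PolarForm F V) :
    ∃ E : Submodule F V, η.TotallySingular E ∧ E ⊓ η.radical = ⊥ ∧
      finrank F E = η.reducedWittIndex := by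
  obtain ⟨X, hX, hr⟩ := η.reduction.exists_finrank_eq_wittIndex
  obtain ⟨g, hg⟩ := η.radical.mkQ.exists_rightInverse_of_surjective (Submodule.range_mkQ _)
  have hg' : ∀ x, η.radical.mkQ (g x) = x := fun x => LinearMap.congr_fun hg x
  have hinj : Function.Injective g := fun x y hxy => by rw [← hg' x, ← hg' y, hxy]
  refine ⟨X.map g, ?_, ?_, ?_⟩
  · have hq : ∀ y ∈ X.map g, (Submodule.Quotient.mk y : V ⧸ η.radical) ∈ X := by
      rintro _ ⟨x, hx, rfl⟩
      have := hg' x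
      rw [Submodule.mkQ_apply] at this
      rwa [this]
    cases η with
    | hermitian σ hσ hσ' h hh => exact fun x hx y hy => hX _ (hq x hx) _ (hq y hy)
    | alternating s hs => exact fun x hx y hy => hX _ (hq x hx) _ (hq y hy)
    | quadratic q => exact fun x hx => hX _ (hq x hx)
  · rw [eq_bot_iff]
    rintro _ ⟨⟨x, hx, rfl⟩, hx'⟩
    have := hg' x
    rw [Submodule.mkQ_apply, (Submodule.Quotient.mk_eq_zero _).mpr hx'] at this
    rw [← this, map_zero]
    exact zero_mem _
  · rw [reducedWittIndex, ← hr]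
    exact (Submodule.equivMapOfInjective g hinj X).finrank_eq.symm

end Bridge

/-! ### Hermitian forms -/

section Hermitian

variable {σ : F →+* F} {h : V →ₛₗ[σ] V →ₗ[F] F}

/-- If the trace `μ + σ μ` vanished identically, `μ = 1` would give `2 = 0`, and then `σ μ = -μ = μ`
for all `μ`. -/
lemma exists_add_ne_zero (hσ' : σ ≠ RingHom.id F) :
    ∃ μ, μ + σ μ ≠ 0 := by
  by_contra! hcon
  apply hσ'
  have h1 := hcon 1
  rw [map_one] at h1
  ext μ
  have := hcon μ
  rw [RingHom.id_apply]
  linear_combination this - μ * h1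

lemma isPolarData_hermitian (hσ : Function.Involutive σ) (hσ' : σ ≠ RingHom.id F)
    (hh : h.IsSymm) : IsPolarData h fun x => h x x = 0 where
  involutive := hσ
  refl := fun {x y} hxy => hh.isRefl x y hxy
  comb := by
    intro x y hx hy hxy a b
    simp [hx, hy, hxy, hh.isRefl x y hxy]
  self := id
  adjust := by
    intro a x ha hax
    have ha : h a a = 0 := ha
    obtain ⟨μ, hμ⟩ := exists_add_ne_zero hσ'
    have hxa : h x a ≠ 0 := fun h0 => hax (hh.isRefl x a h0)
    have e1 : σ (h x a) = h a x := hh.eq x a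
    have e2 : σ (h x x) = h x x := hh.eq x x
    -- Since `h (x + c • a) (x + c • a)` is `h x x` plus the trace of `c * h x a`, that trace has to
    -- be `-h x x`.
    refine ⟨-(h x x * μ) / ((μ + σ μ) * h x a), ?_⟩
    have e3 : σ (μ + σ μ) = μ + σ μ := by rw [map_add, hσ, add_comm]
    simp only [map_add, map_smul, map_smulₛₗ, LinearMap.add_apply, LinearMap.smul_apply,
      smul_eq_mul, ha, map_div₀, map_neg, map_mul, e1, e2, hσ μ]
    rw [add_comm (σ μ) μ]
    field_simp
    ring

lemma hyperbolicExchange_hermitian (hσ' : σ ≠ RingHom.id F)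
    (hh : h.IsSymm) : IsPolarData.HyperbolicExchange h fun x => h x x = 0 := by
  intro p x a b hp hx ha hb hpx hab hpa hpb hxa hxb
  have hp : h p p = 0 := hp
  have hx : h x x = 0 := hx
  have ha : h a a = 0 := ha
  have hb : h b b = 0 := hb
  have hap := hh.isRefl _ _ hpa
  have hbp := hh.isRefl _ _ hpb
  have hax := hh.isRefl _ _ hxa
  have hbx := hh.isRefl _ _ hxb
  obtain ⟨l, hl⟩ : ∃ l, σ l ≠ l := by
    by_contra! hcon
    exact hσ' (RingHom.ext hcon)
  have hl0 : l ≠ 0 := fun h0 => hl (by rw [h0, map_zero])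
  have hσl0 : σ l ≠ 0 := by simpa using hl0
  set T := Submodule.span F {w | ∃ s t : V, s ∈ Submodule.span F {p, x, a, b} ∧
      t ∈ Submodule.span F {p, x, a, b} ∧ h s s = 0 ∧ h t t = 0 ∧ h s t = 0 ∧
      w = ι F s * ι F t} with hT
  have mp : p ∈ Submodule.span F {p, x, a, b} := Submodule.subset_span (by simp)
  have mx : x ∈ Submodule.span F {p, x, a, b} := Submodule.subset_span (by simp)
  have ma : a ∈ Submodule.span F {p, x, a, b} := Submodule.subset_span (by simp)
  have mb : b ∈ Submodule.span F {p, x, a, b} := Submodule.subset_span (by simp)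
  have hpb' : ι F p * ι F b ∈ T := Submodule.subset_span ⟨p, b, mp, mb, hp, hb, hpb, rfl⟩
  have hax' : ι F a * ι F x ∈ T := Submodule.subset_span ⟨a, x, ma, mx, ha, hx, hax, rfl⟩
  -- The vectors `p + c a` and `x - (σ c)⁻¹ b` are singular and orthogonal; expanding their product
  -- leaves two further orthogonal products.
  have key : ∀ c : F, c ≠ 0 →
      ι F p * ι F x - (c * (σ c)⁻¹) • (ι F a * ι F b) ∈ T := by
    intro c hc
    have hσc : σ c ≠ 0 := by simpa using hc
    have h1 : ι F (p + c • a) * ι F (x - (σ c)⁻¹ • b) ∈ T := by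
      refine Submodule.subset_span ⟨_, _, add_mem mp (Submodule.smul_mem _ _ ma),
        sub_mem mx (Submodule.smul_mem _ _ mb), ?_, ?_, ?_, rfl⟩
      · simp [hp, ha, hpa, hap]
      · simp [hx, hb, hxb, hbx]
      · simp [hpx, hab, hpb, hax, hσc]
    have e : ι F p * ι F x - (c * (σ c)⁻¹) • (ι F a * ι F b) =
        ι F (p + c • a) * ι F (x - (σ c)⁻¹ • b) + (σ c)⁻¹ • (ι F p * ι F b) -
          c • (ι F a * ι F x) := by
      simp only [map_add, map_sub, map_smul, add_mul, mul_sub, smul_mul_assoc, mul_smul_comm]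
      module
    rw [e]
    exact sub_mem (add_mem h1 (Submodule.smul_mem _ _ hpb')) (Submodule.smul_mem _ _ hax')
  -- For `c = 1` the factor is 1 and for `c = l` it is not, so the difference isolates `a ∧ b`.
  have k1 := key 1 one_ne_zero
  have k2 := key l hl0
  rw [map_one, inv_one, mul_one, one_smul] at k1
  have hd : l * (σ l)⁻¹ - 1 ≠ 0 := by
    intro h0
    apply hl
    field_simp at h0
    linear_combination -h0
  have k3 := Submodule.smul_mem T (l * (σ l)⁻¹ - 1)⁻¹ (sub_mem k1 k2)
  have e : (l * (σ l)⁻¹ - 1)⁻¹ • (ι F p * ι F x - ι F a * ι F b -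
      (ι F p * ι F x - (l * (σ l)⁻¹) • (ι F a * ι F b))) = ι F a * ι F b := by
    rw [inv_smul_eq_iff₀ hd]
    module
  rw [e] at k3
  simpa using add_mem k1 k3

end Hermitian

/-! ### Quadratic forms -/

section Quadratic

variable (q : QuadraticForm F V)

lemma isPolarData_quadratic : IsPolarData q.polarBilin fun x => q x = 0 where
  involutive := fun _ => rfl
  refl := by
    intro x y hxy
    rw [QuadraticMap.polarBilin_apply_apply, QuadraticMap.polar_comm]
    exact hxy
  comb := by
    intro x y hx hy hxy a b
    rw [QuadraticMap.polarBilin_apply_apply] at hxy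
    rw [QuadraticMap.map_add q, QuadraticMap.map_smul, QuadraticMap.map_smul,
      QuadraticMap.polar_smul_left, QuadraticMap.polar_smul_right, hx, hy, hxy]
    simp
  self := by
    intro x hx
    rw [QuadraticMap.polarBilin_apply_apply, QuadraticMap.polar_self, hx, smul_zero]
  adjust := by
    intro a x ha hax
    rw [QuadraticMap.polarBilin_apply_apply] at hax
    refine ⟨-q x / QuadraticMap.polar q a x, ?_⟩
    rw [QuadraticMap.map_add q, QuadraticMap.map_smul, QuadraticMap.polar_smul_right,
      QuadraticMap.polar_comm q x a, ha]
    simp [hax]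

lemma hyperbolicExchange_quadratic (h2 : (2 : F) ≠ 0) :
    IsPolarData.HyperbolicExchange q.polarBilin fun x => q x = 0 := by
  intro p x a b hp hx ha hb hpx hab hpa hpb hxa hxb
  have hd := isPolarData_quadratic q
  have hs : ∀ u v, q.polarBilin u v = q.polarBilin v u := fun u v => by
    simp only [QuadraticMap.polarBilin_apply_apply]
    exact QuadraticMap.polar_comm _ _ _
  set T := Submodule.span F {w | ∃ s t : V, s ∈ Submodule.span F {p, x, a, b} ∧
      t ∈ Submodule.span F {p, x, a, b} ∧ q s = 0 ∧ q t = 0 ∧ q.polarBilin s t = 0 ∧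
      w = ι F s * ι F t} with hT
  have mp : p ∈ Submodule.span F {p, x, a, b} := Submodule.subset_span (by simp)
  have mx : x ∈ Submodule.span F {p, x, a, b} := Submodule.subset_span (by simp)
  have step : ∀ a' b' : V, a' ∈ Submodule.span F {p, x, a, b} →
      b' ∈ Submodule.span F {p, x, a, b} → q a' = 0 → q b' = 0 → q.polarBilin a' b' = 1 →
      q.polarBilin p a' = 0 → q.polarBilin p b' = 0 → q.polarBilin x a' = 0 →
      q.polarBilin x b' = 0 → ι F p * ι F x - ι F a' * ι F b' ∈ T := by
    intro a b ma mb ha hb hab hpa hpb hxa hxb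
    have h1 : ι F (p + a) * ι F (x - b) ∈ T := by
      refine Submodule.subset_span ⟨_, _, add_mem mp ma, sub_mem mx mb, ?_, ?_, ?_, rfl⟩
      · simpa using hd.comb hp ha hpa 1 1
      · simpa using hd.sub_smul hx hb hxb 1
      · rw [map_add, LinearMap.add_apply, map_sub, map_sub, hpx, hpb, hab, hs a x, hxa]
        ring
    have h2 : ι F p * ι F b ∈ T := Submodule.subset_span ⟨p, b, mp, mb, hp, hb, hpb, rfl⟩
    have h3 : ι F a * ι F x ∈ T :=
      Submodule.subset_span ⟨a, x, ma, mx, ha, hx, (hs a x).trans hxa, rfl⟩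
    have e : ι F p * ι F x - ι F a * ι F b =
        ι F (p + a) * ι F (x - b) + ι F p * ι F b - ι F a * ι F x := by
      simp only [map_add, map_sub, add_mul, mul_sub]
      abel
    rw [e]
    exact sub_mem (add_mem h1 h2) h3
  have ma : a ∈ Submodule.span F {p, x, a, b} := Submodule.subset_span (by simp)
  have mb : b ∈ Submodule.span F {p, x, a, b} := Submodule.subset_span (by simp)
  have k1 := step a b ma mb ha hb hab hpa hpb hxa hxb
  -- Symmetry of the bilinearization allows `a` and `b` to be exchanged, while `b ∧ a = -(a ∧ b)`:
  -- the sum of both relations is `2 p ∧ x`.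
  have k2 := step b a mb ma hb ha ((hs b a).trans hab) hpb hpa hxb hxa
  have k3 := Submodule.smul_mem T (2 : F)⁻¹ (add_mem k1 k2)
  have e : (2 : F)⁻¹ • (ι F p * ι F x - ι F a * ι F b + (ι F p * ι F x - ι F b * ι F a)) =
      ι F p * ι F x := by
    rw [ι_mul_ι_swap b a, inv_smul_eq_iff₀ h2]
    module
  rwa [e] at k3

lemma isAlt_polarBilin [CharP F 2] : q.polarBilin.IsAlt := fun x => by
  have h2 : (2 : F) = 0 := CharTwo.two_eq_zero
  simp [QuadraticMap.polar_self, ← Nat.cast_smul_eq_nsmul F, h2]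

end Quadratic

/-! ### The span of the embedding for each type of form -/

section Dimension

variable [FiniteDimensional F V]

lemma map_submodule_hermitian {σ : F →+* F} (hσ : Function.Involutive σ)
    (hσ' : σ ≠ RingHom.id F) (h : V →ₛₗ[σ] V →ₗ[F] F) (hh : h.IsSymm) {k : ℕ}
    (hk : k ≤ (hermitian σ hσ hσ' h hh).reducedWittIndex) :
    (Projectivization.Subspace.submodule ((hermitian σ hσ hσ' h hh).embeddingSpan k)).map
      (⋀[F]^k V).subtype = gradePiece (⊤ : Submodule F V) k := by
  obtain ⟨E, hE, hr, hd⟩ := (hermitian σ hσ hσ' h hh).exists_totallySingular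
  rw [← hd] at hk
  rw [← (isPolarData_hermitian hσ hσ' hh).singularSpan_eq_gradePiece_top
    (fun x hx => hE x hx x hx) hE hr (hyperbolicExchange_hermitian hσ' hh) hk]
  apply map_submodule_embeddingSpan
  · exact fun X hX => ⟨fun x hx => hX x hx x hx, hX⟩
  · intro l _ hl x hx y hy
    refine hh.isRefl _ _ (IsPolarData.forall_span_left (fun z hz => ?_) y hy)
    exact hh.isRefl _ _ (IsPolarData.forall_span_left (fun w hw => hl w hw z hz) x hx)

lemma map_submodule_alternating (s : LinearMap.BilinForm F V) (hs : s.IsAlt) (k : ℕ) :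
    (Projectivization.Subspace.submodule ((alternating s hs).embeddingSpan k)).map
      (⋀[F]^k V).subtype = singularSpan F (fun x y => s x y = 0) (fun _ => True) k := by
  apply map_submodule_embeddingSpan
  · exact fun X hX => ⟨fun _ _ => trivial, hX⟩
  · intro l _ hl x hx y hy
    refine hs.isRefl _ _ (IsPolarData.forall_span_left (fun z hz => ?_) y hy)
    exact hs.isRefl _ _ (IsPolarData.forall_span_left (fun w hw => hl w hw z hz) x hx)

lemma map_submodule_quadratic (q : QuadraticForm F V) (k : ℕ) :
    (Projectivization.Subspace.submodule ((quadratic q).embeddingSpan k)).map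
      (⋀[F]^k V).subtype =
      singularSpan F (fun x y => q.polarBilin x y = 0) (fun x => q x = 0) k := by
  have hd := isPolarData_quadratic q
  apply map_submodule_embeddingSpan
  · intro X hX
    refine ⟨hX, fun x hx y hy => ?_⟩
    rw [QuadraticMap.polarBilin_apply_apply, QuadraticMap.polar, hX x hx, hX y hy,
      hX _ (add_mem hx hy)]
    simp
  · intro l hS hl x hx
    induction hx using Submodule.span_induction with
    | mem x hx => exact hS x hx
    | zero => exact QuadraticMap.map_zero q
    | add x y hx hy hx' hy' =>
      have : q.polarBilin x y = 0 := by
        refine hd.refl (IsPolarData.forall_span_left (fun z hz => ?_) y hy)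
        exact hd.refl (IsPolarData.forall_span_left (fun w hw => hl w hw z hz) x hx)
      simpa using hd.comb hx' hy' this 1 1
    | smul c x _ hx' => exact hd.smul hx' c

/-- A totally singular subspace that meets the radical trivially, in terms of the
bilinearization. -/
lemma exists_totallySingular_quadratic (q : QuadraticForm F V) :
    ∃ E : Submodule F V, (∀ x ∈ E, q x = 0) ∧
      (∀ x ∈ E, ∀ y ∈ E, q.polarBilin x y = 0) ∧ E ⊓ LinearMap.ker q.polarBilin = ⊥ ∧
      finrank F E = (quadratic q).reducedWittIndex := by
  obtain ⟨E, hE, hr, hd⟩ := (quadratic q).exists_totallySingular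
  refine ⟨E, hE, fun x hx y hy => ?_, ?_, hd⟩
  · rw [QuadraticMap.polarBilin_apply_apply, QuadraticMap.polar, hE x hx, hE y hy,
      hE _ (add_mem hx hy)]
    simp
  -- The kernel of the bilinearization may be larger than the radical of `q`, but a singular vector
  -- of that kernel lies in the radical.
  · rw [eq_bot_iff, ← hr]
    exact fun x hx => ⟨hx.1, hE x hx.1, hx.2⟩

/-- A subspace on which an alternating form vanishes and which meets the radical trivially has at
most half the dimension of the quotient by the radical. -/
lemma two_mul_finrank_add_le {s : LinearMap.BilinForm F V} (hs : s.IsAlt) {E : Submodule F V}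
    (hE : ∀ x ∈ E, ∀ y ∈ E, s x y = 0) (hEs : E ⊓ LinearMap.ker s = ⊥) :
    finrank F (LinearMap.ker s) + 2 * finrank F E ≤ finrank F V := by
  have h1 := LinearMap.BilinForm.finrank_add_finrank_orthogonal hs.isRefl E
  have h2 : E ⊓ s.orthogonal ⊤ = ⊥ := by
    rw [eq_bot_iff, ← hEs]
    refine fun x hx => ⟨hx.1, ?_⟩
    rw [SetLike.mem_coe, LinearMap.mem_ker]
    ext y
    exact hs.isRefl _ _ (hx.2 y trivial)
  -- `E ⊕ Rad` lies in the orthogonal of `E`, whose codimension is `dim E` because `E` meets the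
  -- radical trivially.
  have h3 : E ⊔ LinearMap.ker s ≤ s.orthogonal E := by
    refine sup_le (fun x hx y hy => hE y hy x hx) fun x hx y _ => ?_
    exact hs.isRefl _ _ (by rw [LinearMap.mem_ker.mp hx]; rfl)
  have h4 := Submodule.finrank_mono h3
  have h5 := Submodule.finrank_sup_add_finrank_inf_eq E (LinearMap.ker s)
  rw [hEs, finrank_bot] at h5
  rw [h2, finrank_bot] at h1
  omega

end Dimension

end PolarForm

/-! ### The theorem -/

theorem theorem1 {F : Type u} [Field F] {V : Type v} [AddCommGroup V] [Module F V]
    [FiniteDimensional F V] (N n d₀ d k : ℕ) (hN : finrank F V = N) (hN1 : 1 < N)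
    (hn1 : 1 < n) (hsum : 2 * n + d₀ + d = N)
    (η : PolarForm F V) (hn : η.reducedWittIndex = n) (hd₀ : η.anisotropicDefect = d₀)
    (hd : η.defect = d) (hk1 : 1 ≤ k) (hkn : k ≤ n) :
    (η.IsHermitian →
      (η.embeddingDim k : ℤ) = binomial N k ∧ η.embeddingSpan k = ⊤) ∧
    (η.IsAlternating →
      (η.embeddingDim k : ℤ) = binomial N k - binomial N ((k : ℤ) - 2)) ∧
    (∀ q : QuadraticForm F V, η = PolarForm.quadratic q →
      (¬ CharP F 2 → (η.embeddingDim k : ℤ) = binomial N k) ∧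
      (∀ [CharP F 2],
        (η.embeddingDim k : ℤ) = binomial N k - binomial N ((k : ℤ) - 2)) ∧
      (¬ CharP F 2 ∨ k = 1 → η.embeddingSpan k = ⊤) ∧
      (∀ [CharP F 2],
        η.embeddingSpan k = (PolarForm.bilinearization q).embeddingSpan k)) := by
  refine ⟨fun hη => ?_, fun hη => ?_, ?_⟩
  · cases η with
    | alternating => exact hη.elim
    | quadratic => exact hη.elim
    | hermitian σ hσ hσ' h hh =>
      have e := PolarForm.map_submodule_hermitian hσ hσ' h hh (hkn.trans hn.ge)
      refine ⟨?_, PolarForm.embeddingSpan_eq_top _ _ e⟩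
      rw [PolarForm.embeddingDim_eq _ _ e, ExteriorAlgebra.finrank_gradePiece, finrank_top, hN]
  · cases η with
    | hermitian => exact hη.elim
    | quadratic => exact hη.elim
    | alternating s hs =>
      have hd' : finrank F (LinearMap.ker s) = d := hd
      rw [PolarForm.embeddingDim_eq _ _ (PolarForm.map_submodule_alternating s hs k),
        ExteriorAlgebra.finrank_singularSpan_of_isAlt hs (by omega), hN]
  · rintro q rfl
    obtain ⟨E, hES, hE, hEB, hEn⟩ := PolarForm.exists_totallySingular_quadratic q
    have hkE : k ≤ finrank F E := by omega
    have hq := PolarForm.isPolarData_quadratic q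
    have hodd : ¬ CharP F 2 →
        (Projectivization.Subspace.submodule ((PolarForm.quadratic q).embeddingSpan k)).map
          (⋀[F]^k V).subtype = ExteriorAlgebra.gradePiece (⊤ : Submodule F V) k := by
      intro h2
      rw [PolarForm.map_submodule_quadratic]
      refine hq.singularSpan_eq_gradePiece_top hES hE hEB
        (PolarForm.hyperbolicExchange_quadratic q fun h0 => h2 ?_) hkE
      exact CharTwo.of_one_ne_zero_of_two_eq_zero one_ne_zero h0
    have heven : ∀ [CharP F 2], (PolarForm.quadratic q).embeddingSpan k =
        (PolarForm.bilinearization q).embeddingSpan k := by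
      intro _
      apply Projectivization.Subspace.submodule.injective
      apply Submodule.map_injective_of_injective (⋀[F]^k V).injective_subtype
      exact (PolarForm.map_submodule_quadratic q k).trans
        ((hq.singularSpan_eq_of_isotropic hES hE hEB hkE).trans
          (PolarForm.map_submodule_alternating _ (PolarForm.isAlt_polarBilin q) k).symm)
    refine ⟨fun h2 => ?_, ?_, ?_, heven⟩
    · rw [PolarForm.embeddingDim_eq _ _ (hodd h2), ExteriorAlgebra.finrank_gradePiece,
        finrank_top, hN]
    · intro _
      have hs := PolarForm.isAlt_polarBilin q
      -- Here `d` is the dimension of the radical of `q`, not of `f_q`, so the required bound comes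
      -- from `E`.
      have hE2 := PolarForm.two_mul_finrank_add_le hs hE hEB
      rw [PolarForm.embeddingDim_eq _ _ (PolarForm.map_submodule_quadratic q k),
        hq.singularSpan_eq_of_isotropic hES hE hEB hkE,
        ExteriorAlgebra.finrank_singularSpan_of_isAlt hs (by omega), hN]
    · rintro (h2 | rfl)
      · exact PolarForm.embeddingSpan_eq_top _ _ (hodd h2)
      · by_cases h2 : CharP F 2
        · refine PolarForm.embeddingSpan_eq_top _ _ ((PolarForm.map_submodule_quadratic q 1).trans ?_)
          -- For `k = 1` every vector is isotropic for `f_q`, so there is no condition left.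
          rw [hq.singularSpan_eq_of_isotropic hES hE hEB hkE]
          exact ExteriorAlgebra.singularSpan_one_of_isAlt (PolarForm.isAlt_polarBilin q)
        · exact PolarForm.embeddingSpan_eq_top _ _ (hodd h2)
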